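/- Germs are germs at the origin of complex analytic subsets of $\mathbb{C}^3$, taken with reduced structure. A germ $(Z,0)$ is reducible if it is the union of two analytic germs both different from $(Z,0)$, and irreducible if it is nonempty and not reducible. A hypersurface germ is the zero set of a holomorphic germ $F\not\equiv 0$ with $F(0)=0$; the tangent cone of $F=0$ is the projective plane curve $P=0$, where $P$ is the initial form (lowest-degree nonzero homogeneous Taylor part) of $F$ at $0$. A hyperflex of a plane curve is a point at which some line meets the curve with multiplicity at least $4$ (lines contained in the curve included). There exist irreducible hypersurface germs $(X,0)$ in $\mathbb{C}^3$ such that, for every smooth surface germ $(Y,0)$ in $\mathbb{C}^3$, the intersection $(X\cap Y,0)$ is reducible. More precisely: 1. Let $F$ be holomorphic near $0\in\mathbb{C}^3$ with initial form $P$ of degree $d\ge 4$ such that the tangent cone $P=0$ has no hyperflexes. Then the intersection of $X=\{F=0\}$ with every smooth surface germ $(Y,0)$ is reducible. If moreover $P$ is an irreducible polynomial, then $(X,0)$ is irreducible. (This covers all surface germs whose tangent cone is a smooth irreducible plane curve of degree at least $4$ without hyperflexes.) 2. The quartic form $x^4+y^4+x^2z^2+yz^3+z^4$ is irreducible, and it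 defines a smooth plane curve without hyperflexes. The germ in $(\mathbb{C}^3,0)$ defined by $x^4+y^4+x^2z^2+yz^3+z^4=0$ is irreducible, and its intersection with every smooth surface germ $(Y,0)$ is reducible. 3. Let $Q_1,Q_2$ be quadratic forms defining smooth conics that meet transversally at each of their common points. Then the quartic curve $Q_1Q_2=0$ has no hyperflexes, and for every hypersurface germ $(X,0)$ in $\mathbb{C}^3$ defined by some $F$ with initial form $Q_1Q_2$ (in particular for every irreducible one), the intersection of $(X,0)$ with every smooth surface germ $(Y,0)$ is reducible. -/

import Mathlib

open Filter Topology

/-- Germs at the origin of subsets of `ℂ³` are represented by subsets, and two subsets represent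
the same germ exactly when `X =ᶠ[𝓝 0] Y`.  `IsAnalyticGerm X`: near the origin `X` is the common
zero set of finitely many functions that are holomorphic near the origin. -/
def IsAnalyticGerm (X : Set (Fin 3 → ℂ)) : Prop :=
  ∃ (k : ℕ) (f : Fin k → (Fin 3 → ℂ) → ℂ), (∀ i, AnalyticAt ℂ (f i) 0) ∧
    X =ᶠ[𝓝 0] {x | ∀ i, f i x = 0}

/-- The germ `(X,0)` is reducible: an analytic germ that is the union of two analytic germs,
both different from `(X,0)`. -/
def IsReducibleGerm (X : Set (Fin 3 → ℂ)) : Prop :=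
  IsAnalyticGerm X ∧ ∃ A B : Set (Fin 3 → ℂ), IsAnalyticGerm A ∧ IsAnalyticGerm B ∧
    X =ᶠ[𝓝 0] (A ∪ B : Set (Fin 3 → ℂ)) ∧ ¬ A =ᶠ[𝓝 0] X ∧ ¬ B =ᶠ[𝓝 0] X

/-- The germ `(X,0)` is irreducible: a nonempty analytic germ that is not reducible. -/
def IsIrreducibleGerm (X : Set (Fin 3 → ℂ)) : Prop :=
  IsAnalyticGerm X ∧ (0 : Fin 3 → ℂ) ∈ X ∧ ¬ IsReducibleGerm X

/-- The zero set of a function on `ℂ³`. -/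
def zeroLocus (F : (Fin 3 → ℂ) → ℂ) : Set (Fin 3 → ℂ) := {x | F x = 0}

/-- `(X,0)` is a hypersurface germ: the zero set of one holomorphic germ, not identically zero,
that vanishes at the origin. -/
def IsHypersurfaceGerm (X : Set (Fin 3 → ℂ)) : Prop :=
  ∃ F : (Fin 3 → ℂ) → ℂ, AnalyticAt ℂ F 0 ∧ F 0 = 0 ∧ (¬ ∀ᶠ x in 𝓝 0, F x = 0) ∧
    X =ᶠ[𝓝 0] zeroLocus F

/-- `(Y,0)` is a smooth surface germ in `ℂ³`: the zero set of one holomorphic germ that vanishes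
at the origin and has nonzero differential there. -/
def IsSmoothSurfaceGerm (Y : Set (Fin 3 → ℂ)) : Prop :=
  ∃ G : (Fin 3 → ℂ) → ℂ, AnalyticAt ℂ G 0 ∧ G 0 = 0 ∧ fderiv ℂ G 0 ≠ 0 ∧
    Y =ᶠ[𝓝 0] zeroLocus G

/-- The intersection of the germ `(X,0)` with every smooth surface germ `(Y,0)` is reducible. -/
def AllSmoothSectionsReducible (X : Set (Fin 3 → ℂ)) : Prop :=
  ∀ Y : Set (Fin 3 → ℂ), IsSmoothSurfaceGerm Y → IsReducibleGerm (X ∩ Y)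

/-- `P` is the initial form of the germ `F`, of degree `d`: the nonzero homogeneous part of lowest
degree of its Taylor expansion at the origin.  The tangent cone of `F = 0`, viewed in the
projective plane, is the curve `P = 0` of degree `d`. -/
def IsInitialForm (F : (Fin 3 → ℂ) → ℂ) (d : ℕ) (P : MvPolynomial (Fin 3) ℂ) : Prop :=
  P.IsHomogeneous d ∧ P ≠ 0 ∧
    (fun x => F x - MvPolynomial.eval x P) =o[𝓝 0] (fun x : Fin 3 → ℂ => ‖x‖ ^ d)

/-- The gradient of `P` at `p`. -/
noncomputable def gradientAt (P : MvPolynomial (Fin 3) ℂ) (p : Fin 3 → ℂ) : Fin 3 → ℂ :=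
  fun i => MvPolynomial.eval p (MvPolynomial.pderiv i P)

/-- The projective plane curve `P = 0` is smooth. -/
def IsSmoothPlaneCurve (P : MvPolynomial (Fin 3) ℂ) : Prop :=
  ∀ p : Fin 3 → ℂ, p ≠ 0 → MvPolynomial.eval p P = 0 → gradientAt P p ≠ 0

/-- The one-variable polynomial `T ↦ P (p + T q)`. -/
noncomputable def restrictToLine (P : MvPolynomial (Fin 3) ℂ) (p q : Fin 3 → ℂ) : Polynomial ℂ :=
  MvPolynomial.aeval (fun i => Polynomial.C (p i) + Polynomial.X * Polynomial.C (q i)) P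

/-- The projective plane curve `P = 0` has a hyperflex: the line through some two distinct points
`[p]`, `[q]` of the projective plane meets the curve at `[p]` with multiplicity at least four
(infinite multiplicity, i.e. a line contained in the curve, included). -/
def HasHyperflex (P : MvPolynomial (Fin 3) ℂ) : Prop :=
  ∃ p q : Fin 3 → ℂ, LinearIndependent ℂ ![p, q] ∧ Polynomial.X ^ 4 ∣ restrictToLine P p q

/-- The projective plane curves `P = 0` and `Q = 0` are nowhere tangent: they meet transversally
at each of their common points. -/
def AreNonTangent (P Q : MvPolynomial (Fin 3) ℂ) : Prop :=
  ∀ p : Fin 3 → ℂ, p ≠ 0 → MvPolynomial.eval p P = 0 → MvPolynomial.eval p Q = 0 →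
    LinearIndependent ℂ ![gradientAt P p, gradientAt Q p]

/-- The quartic form `x⁴ + y⁴ + x²z² + yz³ + z⁴`. -/
noncomputable def exampleQuartic : MvPolynomial (Fin 3) ℂ :=
  MvPolynomial.X 0 ^ 4 + MvPolynomial.X 1 ^ 4 + MvPolynomial.X 0 ^ 2 * MvPolynomial.X 2 ^ 2 +
    MvPolynomial.X 1 * MvPolynomial.X 2 ^ 3 + MvPolynomial.X 2 ^ 4

/-! Reducibility of sections. The tangent plane of `Y` at the origin cuts out a line in the
projective plane, and in a chart of `Y` the section is a plane curve germ whose initial form is `P`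
restricted to that line. Without hyperflexes this binary form is nonzero and has no root of
multiplicity four or more; its degree being at least four, it has two distinct roots
(`exists_two_roots_restrictToLine`). So the curve has two tangent directions, and it splits by
tangent direction: `exists_analyticAt_cone` builds a Weierstrass polynomial for the part of the
curve in a narrow cone around one root, its coefficients being symmetric functions of the zeros,
holomorphic by the argument principle and Newton's identities.

Irreducibility. It suffices that, when a product `a * b` vanishes on `X`, one factor does
(`eventually_eq_zero_or_of_mul`). Divide `a` by `F`, degree by degree. Either the division stops at
a remainder whose leading form `A` is not divisible by `P`, or `a` is flat along `X`: smaller there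
than every power of the norm. A flat germ vanishes on `X` (`eventually_eq_zero_of_flat`), since
suitable sums over the points of `X` on parallel lines are holomorphic and flat in one variable. If
neither factor is flat, with leading forms `A` and `B`, then `A * B` vanishes on the cone `P = 0`,
because every point of the cone is approximated by rescaled points of `X`. The Nullstellensatz gives
`P ∣ A * B`, against primality of `P`.

Examples. On a hyperflex line the explicit quartic restricts to a constant times a fourth power of a
linear form. Comparing coefficients and eliminating leaves two coprime polynomials in one slope. For
two conics, a hyperflex line would be tangent to both at the same point. -/

/-! ### Zeros of holomorphic families in a disc, and the argument principle. -/

/-- The quotient by the power is corrected only at `z`, so the factorization is an identity at every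
point and no analyticity is lost elsewhere. Zeros can then be divided out one after another on a
fixed disc. -/
theorem exists_pow_mul_of_analytic_zero {φ : ℂ → ℂ} {z : ℂ} (hz : AnalyticAt ℂ φ z)
    (h0 : φ z = 0) (hne : ¬ ∀ᶠ w in 𝓝 z, φ w = 0) :
    ∃ (n : ℕ) (ψ : ℂ → ℂ), (∀ w, φ w = (w - z) ^ n * ψ w) ∧ AnalyticAt ℂ ψ z ∧ ψ z ≠ 0 ∧
      ∀ w, AnalyticAt ℂ φ w → AnalyticAt ℂ ψ w := by
  obtain ⟨n, g, hg, hgz, hfg⟩ := hz.exists_eventuallyEq_pow_smul_nonzero_iff.mpr hne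
  have hn : n ≠ 0 := by
    rintro rfl
    apply hgz
    simpa [h0] using hfg.self_of_nhds.symm
  have hψz : AnalyticAt ℂ (Function.update (fun w => φ w / (w - z) ^ n) z (g z)) z := by
    refine hg.congr ?_
    filter_upwards [hfg] with w hw
    by_cases hwz : w = z
    · subst hwz; simp
    · have : (w - z) ^ n ≠ 0 := pow_ne_zero _ (sub_ne_zero.mpr hwz)
      rw [Function.update_of_ne hwz, hw, smul_eq_mul]
      field_simp
  refine ⟨n, Function.update (fun w => φ w / (w - z) ^ n) z (g z), fun w => ?_, hψz,
    by simpa using hgz, fun w hw => ?_⟩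
  · by_cases hwz : w = z
    · subst hwz; simp [h0, hn]
    · have : (w - z) ^ n ≠ 0 := pow_ne_zero _ (sub_ne_zero.mpr hwz)
      rw [Function.update_of_ne hwz]
      field_simp
  · by_cases hwz : w = z
    · subst hwz; exact hψz
    · have : (w - z) ^ n ≠ 0 := pow_ne_zero _ (sub_ne_zero.mpr hwz)
      have h1 : AnalyticAt ℂ (fun w => φ w / (w - z) ^ n) w := by
        refine hw.div ?_ this
        fun_prop
      refine h1.congr ?_
      filter_upwards [isOpen_ne.mem_nhds hwz] with x hx
      rw [Function.update_of_ne hx]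

/-- Accumulating zeros would force `φ` to vanish on the whole disc, including its boundary circle.
-/
theorem finite_zeros_closedBall {φ : ℂ → ℂ} {c : ℂ} {R : ℝ} (hR : 0 < R)
    (hφ : ∀ w ∈ Metric.closedBall c R, AnalyticAt ℂ φ w)
    (hs : ∀ w ∈ Metric.sphere c R, φ w ≠ 0) :
    {w | w ∈ Metric.closedBall c R ∧ φ w = 0}.Finite := by
  by_contra hinf
  obtain ⟨x, hx, hacc⟩ := Set.Infinite.exists_accPt_of_subset_isCompact hinf
    (isCompact_closedBall c R) (fun w hw => hw.1)
  have hfr : ∃ᶠ w in 𝓝[≠] x, φ w = 0 :=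
    (accPt_iff_frequently_nhdsNE.mp hacc).mono fun w hw => hw.2
  have h := AnalyticOnNhd.eqOn_zero_of_preconnected_of_frequently_eq_zero
    (f := φ) (U := Metric.closedBall c R) hφ
    (convex_closedBall c R).isPreconnected hx hfr
  obtain ⟨w, hw⟩ := (NormedSpace.sphere_nonempty (x := c)).mpr hR.le
  exact hs w hw (h (Metric.sphere_subset_closedBall hw))

theorem exists_zeros_factorization {c : ℂ} {R : ℝ} (hR : 0 < R) (φ : ℂ → ℂ)
    (hφ : ∀ w ∈ Metric.closedBall c R, AnalyticAt ℂ φ w)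
    (hs : ∀ w ∈ Metric.sphere c R, φ w ≠ 0) :
    ∃ (m : Multiset ℂ) (ψ : ℂ → ℂ), (∀ z ∈ m, z ∈ Metric.ball c R) ∧
      (∀ w ∈ Metric.closedBall c R, AnalyticAt ℂ ψ w ∧ ψ w ≠ 0) ∧
      ∀ w, φ w = (m.map fun z => w - z).prod * ψ w := by
  have key : ∀ (N : ℕ) (φ : ℂ → ℂ), (∀ w ∈ Metric.closedBall c R, AnalyticAt ℂ φ w) →
      (∀ w ∈ Metric.sphere c R, φ w ≠ 0) →
      {w | w ∈ Metric.closedBall c R ∧ φ w = 0}.ncard ≤ N →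
      ∃ (m : Multiset ℂ) (ψ : ℂ → ℂ), (∀ z ∈ m, z ∈ Metric.ball c R) ∧
        (∀ w ∈ Metric.closedBall c R, AnalyticAt ℂ ψ w ∧ ψ w ≠ 0) ∧
        ∀ w, φ w = (m.map fun z => w - z).prod * ψ w := by
    intro N
    induction N with
    | zero =>
      intro φ hφ hs hN
      have hfin := finite_zeros_closedBall hR hφ hs
      have hem : {w | w ∈ Metric.closedBall c R ∧ φ w = 0} = ∅ :=
        (Set.ncard_eq_zero hfin).mp (Nat.le_zero.mp hN)
      refine ⟨0, φ, by simp, fun w hw => ⟨hφ w hw, fun h => ?_⟩, by simp⟩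
      have : w ∈ {w | w ∈ Metric.closedBall c R ∧ φ w = 0} := ⟨hw, h⟩
      rw [hem] at this
      exact this
    | succ N ih =>
      intro φ hφ hs hN
      have hfin := finite_zeros_closedBall hR hφ hs
      by_cases hem : {w | w ∈ Metric.closedBall c R ∧ φ w = 0} = ∅
      · exact ih φ hφ hs (by rw [hem]; simp)
      obtain ⟨z, hz, hz0⟩ := Set.nonempty_iff_ne_empty.mpr hem
      have hzb : z ∈ Metric.ball c R := by
        rcases (Metric.mem_closedBall.mp hz).lt_or_eq with h | h
        · exact h
        · exact absurd hz0 (hs z h)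
      have hne : ¬ ∀ᶠ w in 𝓝 z, φ w = 0 := by
        intro h
        have h' : φ =ᶠ[𝓝 z] 0 := h
        have h2 := AnalyticOnNhd.eqOn_zero_of_preconnected_of_eventuallyEq_zero
          (f := φ) (U := Metric.closedBall c R) hφ
          (convex_closedBall c R).isPreconnected hz h'
        obtain ⟨w, hw⟩ := (NormedSpace.sphere_nonempty (x := c)).mpr hR.le
        exact hs w hw (h2 (Metric.sphere_subset_closedBall hw))
      obtain ⟨n, ψ, hφψ, -, hψz, hψ⟩ := exists_pow_mul_of_analytic_zero (hφ z hz) hz0 hne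
      obtain ⟨m, χ, hm, hχ, hψχ⟩ := ih ψ (fun w hw => hψ w (hφ w hw))
        (fun w hw h => hs w hw (by rw [hφψ, h, mul_zero])) (by
          have hlt : {w | w ∈ Metric.closedBall c R ∧ ψ w = 0}.ncard
              < {w | w ∈ Metric.closedBall c R ∧ φ w = 0}.ncard := by
            refine Set.ncard_lt_ncard ⟨fun w hw => ⟨hw.1, by rw [hφψ, hw.2, mul_zero]⟩,
              fun hsub => hψz (hsub ⟨hz, hz0⟩).2⟩ hfin
          omega)
      refine ⟨Multiset.replicate n z + m, χ, fun y hy => ?_, hχ, fun w => ?_⟩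
      · rcases Multiset.mem_add.mp hy with hy | hy
        · rw [Multiset.eq_of_mem_replicate hy]; exact hzb
        · exact hm y hy
      · rw [hφψ, hψχ]; simp [mul_assoc]
  exact key _ φ hφ hs le_rfl

/-- The logarithmic derivative is additive: each factor `w - z` contributes a Cauchy kernel, which
reproduces `h z`, and the zero-free factor contributes nothing. -/
theorem circleIntegral_mul_logDeriv {c : ℂ} {R : ℝ} (hR : 0 < R) {h ψ : ℂ → ℂ}
    (hh : ∀ w ∈ Metric.closedBall c R, AnalyticAt ℂ h w)
    (hψ : ∀ w ∈ Metric.closedBall c R, AnalyticAt ℂ ψ w ∧ ψ w ≠ 0)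
    (m : Multiset ℂ) (hm : ∀ z ∈ m, z ∈ Metric.ball c R) :
    ∀ φ : ℂ → ℂ, (∀ w, φ w = (m.map fun z => w - z).prod * ψ w) →
    (∮ w in C(c, R), h w * (deriv φ w / φ w)) = 2 * Real.pi * Complex.I * (m.map h).sum := by
  have hhc : DifferentiableOn ℂ h (Metric.closedBall c R) := fun w hw =>
    (hh w hw).differentiableAt.differentiableWithinAt
  induction m using Multiset.induction_on with
  | empty =>
    intro φ hφ
    have : φ = ψ := by funext w; simp [hφ]
    subst this
    simp only [Multiset.map_zero, Multiset.sum_zero, mul_zero]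
    refine Complex.circleIntegral_eq_zero_of_differentiable_on_off_countable hR.le
      Set.countable_empty ?_ ?_
    · intro w hw
      exact ((hh w hw).continuousAt.mul ((hψ w hw).1.deriv.continuousAt.div
        (hψ w hw).1.continuousAt (hψ w hw).2)).continuousWithinAt
    · intro w hw
      have hw := Metric.ball_subset_closedBall hw.1
      exact ((hh w hw).mul ((hψ w hw).1.deriv.div (hψ w hw).1 (hψ w hw).2)).differentiableAt
  | cons z m ih =>
    intro φ hφ
    have hz : z ∈ Metric.ball c R := hm z (Multiset.mem_cons_self z m)
    have hm' : ∀ y ∈ m, y ∈ Metric.ball c R := fun y hy => hm y (Multiset.mem_cons_of_mem hy)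
    set φ₁ : ℂ → ℂ := fun w => (m.map fun z => w - z).prod * ψ w with hφ₁
    have hA : ∀ w ∈ Metric.closedBall c R, AnalyticAt ℂ φ₁ w := by
      intro w hw
      refine AnalyticAt.mul ?_ (hψ w hw).1
      clear * -
      induction m using Multiset.induction_on with
      | empty => simpa using analyticAt_const
      | cons y m ih =>
        simp only [Multiset.map_cons, Multiset.prod_cons]
        exact (analyticAt_id.sub analyticAt_const).mul ih
    have hne : ∀ w ∈ Metric.sphere c R, φ₁ w ≠ 0 := by
      intro w hw
      refine mul_ne_zero (Multiset.prod_ne_zero ?_) (hψ w (Metric.sphere_subset_closedBall hw)).2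
      intro h0
      obtain ⟨y, hy, hy0⟩ := Multiset.mem_map.mp h0
      have := hm' y hy
      rw [← sub_eq_zero.mp hy0] at this
      exact (ne_of_lt (Metric.mem_ball.mp this)) (Metric.mem_sphere.mp hw)
    have hφeq : φ = fun w => (w - z) * φ₁ w := by
      funext w; rw [hφ]; simp [hφ₁, mul_assoc]
    have hint : ∀ w ∈ Metric.sphere c R,
        h w * (deriv φ w / φ w) = (w - z)⁻¹ • h w + h w * (deriv φ₁ w / φ₁ w) := by
      intro w hw
      have hwz : w - z ≠ 0 := by
        intro h0
        rw [sub_eq_zero.mp h0] at hw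
        exact (ne_of_lt (Metric.mem_ball.mp hz)) (Metric.mem_sphere.mp hw)
      have hd : deriv φ w = φ₁ w + (w - z) * deriv φ₁ w := by
        rw [hφeq, deriv_fun_mul (by fun_prop) (hA w (Metric.sphere_subset_closedBall hw)).differentiableAt]
        simp
      rw [hd, hφeq, smul_eq_mul]
      have := hne w hw
      field_simp
    rw [circleIntegral.integral_congr hR.le hint, circleIntegral.integral_add, ih hm' φ₁ (fun _ => rfl)]
    · rw [Complex.circleIntegral_sub_inv_smul_of_differentiable_on_off_countable
        Set.countable_empty hz hhc.continuousOn (fun x hx =>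
          (hh x (Metric.ball_subset_closedBall hx.1)).differentiableAt)]
      simp only [Multiset.map_cons, Multiset.sum_cons, smul_eq_mul]
      ring
    · refine ContinuousOn.circleIntegrable hR.le fun w hw => ?_
      have hwz : w - z ≠ 0 := by
        intro h0
        rw [sub_eq_zero.mp h0] at hw
        exact (ne_of_lt (Metric.mem_ball.mp hz)) (Metric.mem_sphere.mp hw)
      refine ContinuousAt.continuousWithinAt ?_
      exact ((continuousAt_id.sub continuousAt_const).inv₀ hwz).smul
        (hh w (Metric.sphere_subset_closedBall hw)).continuousAt
    · refine ContinuousOn.circleIntegrable hR.le fun w hw => ?_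
      have hw' := Metric.sphere_subset_closedBall hw
      exact ((hh w hw').continuousAt.mul ((hA w hw').deriv.continuousAt.div
        (hA w hw').continuousAt (hne w hw))).continuousWithinAt

/-- The circle integral of a function analytic in a parameter is holomorphic in the parameter. -/
theorem differentiableOn_circleIntegral {U : Set ℂ} (hU : IsOpen U) {c : ℂ} {R : ℝ} (hR : 0 ≤ R)
    {H : ℂ × ℂ → ℂ} (hH : ∀ τ ∈ U, ∀ w ∈ Metric.sphere c R, AnalyticAt ℂ H (τ, w)) :
    DifferentiableOn ℂ (fun τ => ∮ w in C(c, R), H (τ, w)) U := by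
  intro τ₀ hτ₀
  obtain ⟨ε, hε, hεU⟩ := Metric.nhds_basis_closedBall.mem_iff.mp (hU.mem_nhds hτ₀)
  set H' : ℂ × ℂ → ℂ := fun p => fderiv ℂ H p (1, 0) with hH'
  have hH'a : ∀ τ ∈ U, ∀ w ∈ Metric.sphere c R, ContinuousAt H' (τ, w) := by
    intro τ hτ w hw
    exact ((hH τ hτ w hw).fderiv.continuousAt).clm_apply continuousAt_const
  have hcomp : IsCompact (Metric.closedBall τ₀ ε ×ˢ Metric.sphere c R) :=
    (isCompact_closedBall _ _).prod (isCompact_sphere _ _)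
  obtain ⟨B, hB⟩ := hcomp.exists_bound_of_continuousOn (f := H')
    (fun p hp => (hH'a p.1 (hεU hp.1) p.2 hp.2).continuousWithinAt)
  have hcm : ∀ θ : ℝ, circleMap c R θ ∈ Metric.sphere c R := circleMap_mem_sphere c hR
  have hcont : ∀ τ ∈ U, Continuous fun θ : ℝ => H (τ, circleMap c R θ) := by
    intro τ hτ
    refine continuous_iff_continuousAt.mpr fun θ => ?_
    exact ContinuousAt.comp (f := fun θ : ℝ => (τ, circleMap c R θ)) (g := H)
      (hH τ hτ _ (hcm θ)).continuousAt (by fun_prop)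
  have hcont' : Continuous fun θ : ℝ => H' (τ₀, circleMap c R θ) := by
    refine continuous_iff_continuousAt.mpr fun θ => ?_
    exact ContinuousAt.comp (f := fun θ : ℝ => (τ₀, circleMap c R θ)) (g := H')
      (hH'a τ₀ hτ₀ _ (hcm θ)) (by fun_prop)
  have hdc : Continuous fun θ : ℝ => deriv (circleMap c R) θ := by
    simp only [deriv_circleMap]; fun_prop
  have key := intervalIntegral.hasDerivAt_integral_of_dominated_loc_of_deriv_le
    (μ := MeasureTheory.volume) (a := 0) (b := 2 * Real.pi)
    (F := fun τ θ => deriv (circleMap c R) θ • H (τ, circleMap c R θ))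
    (F' := fun τ θ => deriv (circleMap c R) θ • H' (τ, circleMap c R θ))
    (x₀ := τ₀) (s := Metric.closedBall τ₀ ε) (bound := fun _ => |R| * B)
    (Metric.closedBall_mem_nhds _ hε)
    (by
      filter_upwards [hU.mem_nhds hτ₀] with τ hτ
      exact (hdc.smul (hcont τ hτ)).aestronglyMeasurable)
    ((hdc.smul (hcont τ₀ hτ₀)).intervalIntegrable _ _)
    ((hdc.smul hcont').aestronglyMeasurable)
    (Eventually.of_forall fun θ _ τ hτ => by
      rw [norm_smul]
      have h1 : ‖deriv (circleMap c R) θ‖ = |R| := by simp [deriv_circleMap]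
      rw [h1]
      exact mul_le_mul_of_nonneg_left (hB _ ⟨hτ, hcm θ⟩) (abs_nonneg R))
    intervalIntegrable_const
    (Eventually.of_forall fun θ _ τ hτ => by
      have h1 : HasFDerivAt H (fderiv ℂ H (τ, circleMap c R θ)) (τ, circleMap c R θ) :=
        (hH τ (hεU hτ) _ (hcm θ)).differentiableAt.hasFDerivAt
      have h2 : HasDerivAt (fun τ : ℂ => (τ, circleMap c R θ)) ((1 : ℂ), (0 : ℂ)) τ :=
        (hasDerivAt_id τ).prodMk (hasDerivAt_const τ _)
      exact (h1.comp_hasDerivAt τ h2).const_mul (deriv (circleMap c R) θ))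
  exact key.2.differentiableAt.differentiableWithinAt

/-- Sums over the zeros of a family of holomorphic functions on a disc, none of which vanishes on
the boundary circle, depend holomorphically on the parameter. -/
theorem exists_multiset_zeros {U : Set ℂ} (hU : IsOpen U) {c : ℂ} {R : ℝ} (hR : 0 < R)
    {Φ : ℂ × ℂ → ℂ} (hΦ : ∀ τ ∈ U, ∀ w ∈ Metric.closedBall c R, AnalyticAt ℂ Φ (τ, w))
    (hs : ∀ τ ∈ U, ∀ w ∈ Metric.sphere c R, Φ (τ, w) ≠ 0) :
    ∃ m : ℂ → Multiset ℂ,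
      (∀ τ ∈ U, ∀ w, w ∈ m τ ↔ w ∈ Metric.closedBall c R ∧ Φ (τ, w) = 0) ∧
      ∀ h : ℂ × ℂ → ℂ, (∀ τ ∈ U, ∀ w ∈ Metric.closedBall c R, AnalyticAt ℂ h (τ, w)) →
        DifferentiableOn ℂ (fun τ => ((m τ).map fun w => h (τ, w)).sum) U := by
  have hslice : ∀ {h : ℂ × ℂ → ℂ} {τ w : ℂ}, AnalyticAt ℂ h (τ, w) →
      AnalyticAt ℂ (fun w => h (τ, w)) w := fun {h τ w} hh =>
    AnalyticAt.fun_comp (g := h) (f := fun w => (τ, w)) hh (by fun_prop)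
  have hex : ∀ τ, ∃ (m : Multiset ℂ) (ψ : ℂ → ℂ), τ ∈ U → (∀ z ∈ m, z ∈ Metric.ball c R) ∧
      (∀ w ∈ Metric.closedBall c R, AnalyticAt ℂ ψ w ∧ ψ w ≠ 0) ∧
      ∀ w, Φ (τ, w) = (m.map fun z => w - z).prod * ψ w := by
    intro τ
    by_cases hτ : τ ∈ U
    · obtain ⟨m, ψ, h⟩ := exists_zeros_factorization hR (fun w => Φ (τ, w))
        (fun w hw => hslice (hΦ τ hτ w hw)) (hs τ hτ)
      exact ⟨m, ψ, fun _ => h⟩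
    · exact ⟨0, 0, fun h => absurd h hτ⟩
  choose m ψ hm using hex
  refine ⟨m, fun τ hτ w => ⟨fun hw => ?_, fun hw => ?_⟩, fun h hh => ?_⟩
  · obtain ⟨h1, h2, h3⟩ := hm τ hτ
    refine ⟨Metric.ball_subset_closedBall (h1 w hw), ?_⟩
    rw [h3, Multiset.prod_eq_zero, zero_mul]
    exact Multiset.mem_map.mpr ⟨w, hw, sub_self w⟩
  · obtain ⟨h1, h2, h3⟩ := hm τ hτ
    have h4 := hw.2
    rw [h3, mul_eq_zero, or_iff_left (h2 w hw.1).2, Multiset.prod_eq_zero_iff] at h4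
    obtain ⟨z, hz, hz0⟩ := Multiset.mem_map.mp h4
    rwa [sub_eq_zero.mp hz0]
  · have hint := differentiableOn_circleIntegral hU hR.le (c := c)
      -- Writing the derivative in `w` as a value of the full differential makes the integrand
      -- jointly analytic in parameter and variable.
      (H := fun p => h p * (fderiv ℂ Φ p (0, 1) / Φ p)) (by
        intro τ hτ w hw
        have hw' := Metric.sphere_subset_closedBall hw
        have h1 : AnalyticAt ℂ (fun p => fderiv ℂ Φ p (0, 1)) (τ, w) :=
          ((ContinuousLinearMap.apply ℂ ℂ ((0, 1) : ℂ × ℂ)).analyticAt _).comp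
            (hΦ τ hτ w hw').fderiv
        exact (hh τ hτ w hw').mul (h1.div (hΦ τ hτ w hw') (hs τ hτ w hw)))
    refine (hint.const_mul (2 * Real.pi * Complex.I)⁻¹).congr fun τ hτ => ?_
    obtain ⟨h1, h2, h3⟩ := hm τ hτ
    have h4 := circleIntegral_mul_logDeriv hR (h := fun w => h (τ, w))
      (fun w hw => hslice (hh τ hτ w hw)) h2 (m τ) h1 (fun w => Φ (τ, w)) h3
    have h5 : (∮ w in C(c, R), h (τ, w) * (fderiv ℂ Φ (τ, w) (0, 1) / Φ (τ, w))) =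
        ∮ w in C(c, R), h (τ, w) * (deriv (fun w => Φ (τ, w)) w / Φ (τ, w)) := by
      refine circleIntegral.integral_congr hR.le fun w hw => ?_
      have h6 : HasDerivAt (fun w => Φ (τ, w)) (fderiv ℂ Φ (τ, w) (0, 1)) w :=
        (hΦ τ hτ w (Metric.sphere_subset_closedBall hw)).differentiableAt.hasFDerivAt.comp_hasDerivAt
          w ((hasDerivAt_const w τ).prodMk (hasDerivAt_id w))
      simp only [h6.deriv]
    simp only [h5, h4]
    have : (2 * Real.pi * Complex.I : ℂ) ≠ 0 := by simp [Real.pi_ne_zero]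
    field_simp

/-- The number of zeros is a continuous function with integer values. -/
theorem exists_card_eq_of_differentiableOn {U : Set ℂ} (hU : IsPreconnected U)
    {m : ℂ → Multiset ℂ}
    (h : DifferentiableOn ℂ (fun τ => ((m τ).map fun _ => (1 : ℂ)).sum) U) :
    ∃ k, ∀ τ ∈ U, (m τ).card = k := by
  rcases U.eq_empty_or_nonempty with rfl | ⟨τ₀, hτ₀⟩
  · exact ⟨0, by simp⟩
  refine ⟨(m τ₀).card, fun τ hτ => ?_⟩
  have hc : ContinuousOn (fun τ => ((m τ).card : ℝ)) U := by
    have := Complex.continuous_re.comp_continuousOn h.continuousOn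
    refine this.congr fun τ _ => ?_
    simp
  have hcn : ContinuousOn (fun τ => (m τ).card) U := by
    rw [continuousOn_iff_continuous_domRestrict] at hc ⊢
    exact Nat.isClosedEmbedding_coe_real.isEmbedding.continuous_iff.mpr hc
  exact hU.constant hcn hτ hτ₀

/-- Newton's identities, which pass from the power sums, known to be holomorphic, to the
coefficients of a Weierstrass polynomial. -/
theorem Multiset.mul_esymm_eq_sum (s : Multiset ℂ) (j : ℕ) :
    j * s.esymm j = (-1) ^ (j + 1) *
      ∑ a ∈ Finset.HasAntidiagonal.antidiagonal j with a.1 < j,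
        (-1) ^ a.1 * s.esymm a.1 * (s.map fun x => x ^ a.2).sum := by
  obtain ⟨k, t, rfl⟩ : ∃ (k : ℕ) (t : Fin k → ℂ), s = Finset.univ.val.map t := by
    refine ⟨s.card, fun i => s.toList.get (i.cast (by simp)), ?_⟩
    conv_lhs => rw [← Multiset.coe_toList s]
    rw [Fin.univ_val_map]
    congr 1
    apply List.ext_get <;> simp
  have h := congrArg (MvPolynomial.aeval t)
    (MvPolynomial.mul_esymm_eq_sum (Fin k) ℂ j)
  simp only [map_mul, map_natCast, map_pow, map_neg, map_one, map_sum,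
    MvPolynomial.aeval_esymm_eq_multiset_esymm, MvPolynomial.psum, MvPolynomial.aeval_X] at h
  rw [h]
  simp only [Multiset.map_map, Function.comp_def]
  rfl

/-- The punctured disc is the image of a half-plane under the exponential. -/
theorem isPreconnected_ball_diff_zero (ε : ℝ) :
    IsPreconnected (Metric.ball (0 : ℂ) ε \ {0}) := by
  rcases le_or_gt ε 0 with h | h
  · rw [Metric.ball_eq_empty.mpr h, Set.empty_sdiff]
    exact isPreconnected_empty
  have heq : Metric.ball (0 : ℂ) ε \ {0} = Complex.exp '' {z | z.re < Real.log ε} := by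
    ext z
    simp only [Set.mem_sdiff, Metric.mem_ball, dist_zero_right, Set.mem_singleton_iff,
      Set.mem_image, Set.mem_ofPred_eq]
    constructor
    · rintro ⟨h1, h2⟩
      refine ⟨Complex.log z, ?_, Complex.exp_log h2⟩
      rw [Complex.log_re]
      exact Real.log_lt_log (norm_pos_iff.mpr h2) h1
    · rintro ⟨w, hw, rfl⟩
      refine ⟨?_, Complex.exp_ne_zero w⟩
      rw [Complex.norm_exp]
      exact (Real.lt_log_iff_exp_lt h).mp hw
  rw [heq]
  exact (convex_halfSpace_re_lt _).isPreconnected.image _ Complex.continuous_exp.continuousOn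

/-- A holomorphic function on a punctured disc that is flat at the centre vanishes. -/
theorem eq_zero_of_flat {S : ℂ → ℂ} {ε : ℝ}
    (hS : DifferentiableOn ℂ S (Metric.ball 0 ε \ {0}))
    (hflat : ∀ n : ℕ, ∃ C : ℝ, ∀ᶠ τ in 𝓝[≠] (0 : ℂ), ‖S τ‖ ≤ C * ‖τ‖ ^ n) :
    ∀ τ ∈ Metric.ball (0 : ℂ) ε \ {0}, S τ = 0 := by
  intro τ₀ hτ₀
  have hε : 0 < ε := Metric.pos_of_mem_ball hτ₀.1
  set T : ℂ → ℂ := Function.update S 0 0 with hT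
  have hTS : ∀ τ, τ ≠ 0 → T τ = S τ := fun τ h => Function.update_of_ne h _ _
  have hTn : ∀ τ, τ ≠ 0 → T =ᶠ[𝓝 τ] S := fun τ h => by
    filter_upwards [isOpen_ne.mem_nhds h] with x hx using hTS x hx
  have hopen : IsOpen (Metric.ball (0 : ℂ) ε \ {0}) :=
    Metric.isOpen_ball.sdiff isClosed_singleton
  have hTd : ∀ τ ∈ Metric.ball (0 : ℂ) ε \ {0}, DifferentiableAt ℂ T τ := fun τ hτ =>
    ((hS τ hτ).differentiableAt (hopen.mem_nhds hτ)).congr_of_eventuallyEq (hTn τ hτ.2)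
  have hflatT : ∀ n : ℕ, ∃ C : ℝ, ∀ᶠ τ in 𝓝[≠] (0 : ℂ), ‖T τ‖ ≤ C * ‖τ‖ ^ n := fun n => by
    obtain ⟨C, hC⟩ := hflat n
    refine ⟨C, ?_⟩
    filter_upwards [hC, self_mem_nhdsWithin] with τ h1 h2
    rwa [hTS τ h2]
  have hT0 : AnalyticAt ℂ T 0 := by
    refine Complex.analyticAt_of_differentiable_on_punctured_nhds_of_continuousAt ?_ ?_
    · filter_upwards [self_mem_nhdsWithin, mem_nhdsWithin_of_mem_nhds
        (Metric.ball_mem_nhds 0 hε)] with τ h1 h2 using hTd τ ⟨h2, h1⟩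
    · rw [continuousAt_iff_punctured_nhds]
      have hT00 : T 0 = 0 := by simp [hT]
      rw [hT00]
      -- The first power already forces the limit zero, so the singularity at the centre is
      -- removable.
      obtain ⟨C, hC⟩ := hflatT 1
      refine squeeze_zero_norm' hC ?_
      have : Tendsto (fun τ : ℂ => C * ‖τ‖ ^ 1) (𝓝 0) (𝓝 (C * ‖(0 : ℂ)‖ ^ 1)) :=
        (Continuous.tendsto (by fun_prop) 0)
      simp only [norm_zero, pow_one, mul_zero] at this ⊢
      exact this.mono_left nhdsWithin_le_nhds
  have hTa : AnalyticOnNhd ℂ T (Metric.ball 0 ε) := by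
    refine DifferentiableOn.analyticOnNhd (fun τ hτ => ?_) Metric.isOpen_ball
    by_cases h0 : τ = 0
    · rw [h0]; exact hT0.differentiableAt.differentiableWithinAt
    · exact (hTd τ ⟨hτ, h0⟩).differentiableWithinAt
  have hev : ∀ᶠ τ in 𝓝 (0 : ℂ), T τ = 0 := by
    by_contra hne
    obtain ⟨n, g, hg, hg0, hTg⟩ := hT0.exists_eventuallyEq_pow_smul_nonzero_iff.mpr hne
    -- A zero of exact order `n` contradicts the flatness bound of order `n + 1`.
    obtain ⟨C, hC⟩ := hflatT (n + 1)
    apply hg0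
    have h1 : Tendsto g (𝓝[≠] 0) (𝓝 (g 0)) := hg.continuousAt.tendsto.mono_left nhdsWithin_le_nhds
    have h2 : Tendsto g (𝓝[≠] 0) (𝓝 0) := by
      refine squeeze_zero_norm' (a := fun τ : ℂ => C * ‖τ‖) ?_ ?_
      · filter_upwards [hC, mem_nhdsWithin_of_mem_nhds hTg, self_mem_nhdsWithin] with τ h3 h4 h5
        have h4 : T τ = (τ - 0) ^ n • g τ := h4
        have hpos : 0 < ‖τ‖ ^ n := pow_pos (norm_pos_iff.mpr h5) n
        rw [h4, sub_zero, norm_smul, norm_pow, pow_succ] at h3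
        refine le_of_mul_le_mul_left (h3.trans_eq ?_) hpos
        ring
      · have : Tendsto (fun τ : ℂ => C * ‖τ‖) (𝓝 0) (𝓝 (C * ‖(0 : ℂ)‖)) :=
          (Continuous.tendsto (by fun_prop) 0)
        simp only [norm_zero, mul_zero] at this
        exact this.mono_left nhdsWithin_le_nhds
    exact tendsto_nhds_unique h1 h2
  have := hTa.eqOn_zero_of_preconnected_of_eventuallyEq_zero
    (convex_ball 0 ε).isPreconnected (Metric.mem_ball_self hε) hev hτ₀.1
  rw [← hTS τ₀ hτ₀.2]; exact this

/-! ### Rescaling a germ towards its initial form. -/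

theorem exists_pos_le_norm_of_isCompact {E : Type*} [TopologicalSpace E] {p : E → ℂ} {K : Set E} (hK : IsCompact K) (hpc : ContinuousOn p K)
    (hne : ∀ x ∈ K, p x ≠ 0) : ∃ c : ℝ, 0 < c ∧ ∀ x ∈ K, c ≤ ‖p x‖ := by
  rcases K.eq_empty_or_nonempty with rfl | hKn
  · exact ⟨1, one_pos, by simp⟩
  obtain ⟨x, hx, hmin⟩ := hK.exists_isMinOn hKn hpc.norm
  exact ⟨‖p x‖, norm_pos_iff.mpr (hne x hx), fun y hy => hmin hy⟩

theorem eventually_forall_smul_of_isBounded {E : Type*} [NormedAddCommGroup E] [NormedSpace ℂ E]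
    {P : E → Prop} (hP : ∀ᶠ x in 𝓝 0, P x) {K : Set E} (hK : Bornology.IsBounded K) :
    ∀ᶠ τ in 𝓝 (0 : ℂ), ∀ x ∈ K, P (τ • x) := by
  obtain ⟨B, hB0, hB⟩ := hK.exists_pos_norm_le
  obtain ⟨ε, hε, h⟩ := Metric.eventually_nhds_iff.mp hP
  refine Metric.eventually_nhds_iff.mpr ⟨ε / B, div_pos hε hB0, fun τ hτ x hx => h ?_⟩
  rw [dist_zero_right] at hτ ⊢
  rw [norm_smul]
  exact (mul_le_mul_of_nonneg_left (hB x hx) (norm_nonneg τ)).trans_lt ((lt_div_iff₀ hB0).mp hτ)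

section
variable {E : Type*} [NormedAddCommGroup E] [NormedSpace ℂ E] {F p : E → ℂ} {d : ℕ}

/-- After rescaling by `τ` and dividing by `τ ^ d`, the germ converges to its initial form uniformly
on bounded sets. All comparisons between `F = 0` and its tangent cone rest on this. -/
theorem eventually_norm_sub_le (hp : ∀ (c : ℂ) x, p (c • x) = c ^ d * p x)
    (hF : (fun x => F x - p x) =o[𝓝 0] fun x => ‖x‖ ^ d) {K : Set E}
    (hK : Bornology.IsBounded K) {η : ℝ} (hη : 0 < η) :
    ∀ᶠ τ in 𝓝 (0 : ℂ), ∀ x ∈ K, ‖F (τ • x) - τ ^ d * p x‖ ≤ η * ‖τ‖ ^ d := by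
  obtain ⟨B, hB0, hB⟩ := hK.exists_pos_norm_le
  have hη' : 0 < η / B ^ d := div_pos hη (pow_pos hB0 d)
  obtain ⟨ε, hε, h⟩ := Metric.eventually_nhds_iff.mp (hF.def hη')
  refine Metric.eventually_nhds_iff.mpr ⟨ε / B, div_pos hε hB0, fun τ hτ x hx => ?_⟩
  rw [dist_zero_right] at hτ
  have h1 : ‖τ • x‖ ≤ ‖τ‖ * B := by
    rw [norm_smul]; exact mul_le_mul_of_nonneg_left (hB x hx) (norm_nonneg τ)
  have h2 := h (y := τ • x) (by
    rw [dist_zero_right]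
    exact h1.trans_lt ((lt_div_iff₀ hB0).mp hτ))
  rw [hp, norm_pow, norm_norm] at h2
  calc ‖F (τ • x) - τ ^ d * p x‖ ≤ η / B ^ d * ‖τ • x‖ ^ d := h2
    _ ≤ η / B ^ d * (‖τ‖ * B) ^ d := by gcongr
    _ = η * ‖τ‖ ^ d := by
      have := pow_pos hB0 d
      rw [mul_pow]; field_simp

theorem eventually_ne_zero_of_isCompact (hp : ∀ (c : ℂ) x, p (c • x) = c ^ d * p x)
    (hF : (fun x => F x - p x) =o[𝓝 0] fun x => ‖x‖ ^ d) {K : Set E}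
    (hK : IsCompact K) (hpc : Continuous p) (hne : ∀ x ∈ K, p x ≠ 0) :
    ∀ᶠ τ in 𝓝 (0 : ℂ), τ ≠ 0 → ∀ x ∈ K, F (τ • x) ≠ 0 := by
  obtain ⟨c, hc, hcK⟩ := exists_pos_le_norm_of_isCompact hK hpc.continuousOn hne
  filter_upwards [eventually_norm_sub_le hp hF hK.isBounded (half_pos hc)] with τ hτ h0 x hx hFx
  have h1 := hτ x hx
  have hpos : 0 < ‖τ‖ ^ d := pow_pos (norm_pos_iff.mpr h0) d
  rw [hFx, zero_sub, norm_neg, norm_mul, norm_pow] at h1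
  have h2 := mul_le_mul_of_nonneg_left (hcK x hx) hpos.le
  nlinarith

/-- Near a point of the tangent cone there are points of the rescaled hypersurface. -/
theorem eventually_exists_zero_near (hp : ∀ (c : ℂ) x, p (c • x) = c ^ d * p x)
    (hFa : AnalyticAt ℂ F 0)
    (hF : (fun x => F x - p x) =o[𝓝 0] fun x => ‖x‖ ^ d) (hpc : Continuous p) {v e : E}
    (hv : p v = 0) (hpa : AnalyticAt ℂ (fun w : ℂ => p (v + w • e)) 0)
    (hne : ¬ ∀ᶠ w in 𝓝 (0 : ℂ), p (v + w • e) = 0) {r : ℝ} (hr : 0 < r) :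
    ∀ᶠ τ in 𝓝 (0 : ℂ), τ ≠ 0 → ∃ w : ℂ, ‖w‖ < r ∧ F (τ • (v + w • e)) = 0 := by
  have h1 := hpa.eventually_eq_zero_or_eventually_ne_zero.resolve_left hne
  obtain ⟨ρ₀, hρ₀, h2⟩ := Metric.eventually_nhds_iff.mp (eventually_nhdsWithin_iff.mp h1)
  obtain ⟨ρ, hρ, hρr⟩ := exists_between (lt_min hρ₀ hr)
  have hl : Continuous fun w : ℂ => v + w • e := by fun_prop
  set K : Set E := (fun w : ℂ => v + w • e) '' Metric.closedBall 0 ρ with hKdef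
  have hK : IsCompact K := (isCompact_closedBall _ _).image hl
  set K' : Set E := (fun w : ℂ => v + w • e) '' Metric.sphere 0 ρ with hK'def
  have hK' : IsCompact K' := (isCompact_sphere _ _).image hl
  obtain ⟨c, hc, hcK⟩ := exists_pos_le_norm_of_isCompact hK' hpc.continuousOn (by
    rintro _ ⟨w, hw, rfl⟩
    rw [mem_sphere_zero_iff_norm] at hw
    refine h2 (y := w) ?_ ?_
    · rw [dist_zero_right, hw]; exact hρr.trans_le (min_le_left _ _)
    · rintro rfl; rw [norm_zero] at hw; exact hρ.ne hw)
  -- With error `c / 3`, the rescaled `F` has norm at least `2c / 3` on the circle and at most `c /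
  -- 3` at the centre, where `p` vanishes. If it had no zero in the disc, the maximum principle for
  -- its reciprocal would be violated.
  filter_upwards [eventually_norm_sub_le hp hF hK.isBounded (by positivity : 0 < c / 3),
    eventually_forall_smul_of_isBounded hFa.eventually_analyticAt hK.isBounded] with τ hτ hτa h0
  by_contra! hno
  have hpos : 0 < ‖τ‖ ^ d := pow_pos (norm_pos_iff.mpr h0) d
  have hKK : ∀ w ∈ Metric.sphere (0 : ℂ) ρ, 2 * c / 3 * ‖τ‖ ^ d ≤ ‖F (τ • (v + w • e))‖ := by
    intro w hw
    have h3 := hτ _ ⟨w, Metric.sphere_subset_closedBall hw, rfl⟩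
    have h4 := mul_le_mul_of_nonneg_left (hcK _ ⟨w, hw, rfl⟩) hpos.le
    have h5 := norm_sub_norm_le (τ ^ d * p (v + w • e)) (F (τ • (v + w • e)))
    rw [norm_sub_rev, norm_mul, norm_pow] at h5
    simp only at h3 h4
    linarith
  have hFne : ∀ w ∈ Metric.closedBall (0 : ℂ) ρ, F (τ • (v + w • e)) ≠ 0 := by
    intro w hw
    rw [mem_closedBall_zero_iff] at hw
    exact hno w (hw.trans_lt (hρr.trans_le (min_le_right _ _)))
  have hd : ∀ w ∈ Metric.closedBall (0 : ℂ) ρ,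
      DifferentiableAt ℂ (fun w : ℂ => (F (τ • (v + w • e)))⁻¹) w := by
    intro w hw
    refine DifferentiableAt.fun_inv ?_ (hFne w hw)
    exact DifferentiableAt.fun_comp' w (g := F) (f := fun w : ℂ => τ • (v + w • e))
      (hτa _ ⟨w, hw, rfl⟩).differentiableAt (by fun_prop)
  have hmax := Complex.norm_le_of_forall_mem_frontier_norm_le (U := Metric.ball (0 : ℂ) ρ)
    (f := fun w : ℂ => (F (τ • (v + w • e)))⁻¹) (C := (2 * c / 3 * ‖τ‖ ^ d)⁻¹)
    Metric.isBounded_ball ⟨fun w hw => (hd w (Metric.ball_subset_closedBall hw)).differentiableWithinAt,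
      fun w hw => (hd w (Metric.closure_ball_subset_closedBall hw)).continuousAt.continuousWithinAt⟩
    (fun w hw => by
      rw [frontier_ball _ hρ.ne'] at hw
      rw [norm_inv]
      exact inv_anti₀ (by positivity) (hKK w hw))
    (subset_closure (Metric.mem_ball_self hρ))
  have h3 := hτ (v + (0 : ℂ) • e) ⟨0, Metric.mem_closedBall_self hρ.le, rfl⟩
  have h0F := hFne 0 (Metric.mem_closedBall_self hρ.le)
  simp only [zero_smul, add_zero, hv, mul_zero, sub_zero, norm_inv] at h3 hmax h0F
  have h4 := (inv_le_inv₀ (norm_pos_iff.mpr h0F) (by positivity)).mp hmax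
  have : 0 < c * ‖τ‖ ^ d := by positivity
  linarith

end

/-! ### Flat germs vanish on the hypersurface. -/

theorem Multiset.sum_map_eq_card_filter_mul {α R : Type*} [Semiring R] {g : α → R} {P : α → Prop}
    [DecidablePred P] {c : R} (s : Multiset α) (h1 : ∀ w ∈ s, P w → g w = c)
    (h0 : ∀ w ∈ s, ¬ P w → g w = 0) : (s.map g).sum = (s.filter P).card * c := by
  induction s using Multiset.induction_on with
  | empty => simp
  | cons w s ih =>
    have ih' := ih (fun x hx => h1 x (Multiset.mem_cons_of_mem hx))
      (fun x hx => h0 x (Multiset.mem_cons_of_mem hx))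
    by_cases hw : P w
    · rw [Multiset.map_cons, Multiset.sum_cons, ih', Multiset.filter_cons_of_pos _ hw,
        h1 w (Multiset.mem_cons_self w s) hw, Multiset.card_cons]
      push_cast
      rw [add_mul, one_mul, add_comm]
    · rw [Multiset.map_cons, Multiset.sum_cons, ih', Multiset.filter_cons_of_neg _ hw,
        h0 w (Multiset.mem_cons_self w s) hw, zero_add]

/-- A function that is flat along a hypersurface germ vanishes on it. -/
theorem eventually_eq_zero_of_flat {E : Type*} [NormedAddCommGroup E] [NormedSpace ℂ E]
    [ProperSpace E] {F p a : E → ℂ} {d : ℕ} (hd : d ≠ 0)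
    (hp : ∀ (c : ℂ) x, p (c • x) = c ^ d * p x)
    (hFa : AnalyticAt ℂ F 0) (haa : AnalyticAt ℂ a 0)
    (hF : (fun x => F x - p x) =o[𝓝 0] fun x => ‖x‖ ^ d) (hpc : Continuous p) {e : E}
    (he : p e ≠ 0)
    (hflat : ∀ n : ℕ, ∃ C : ℝ, ∀ᶠ x in 𝓝 0, F x = 0 → ‖a x‖ ≤ C * ‖x‖ ^ n) :
    ∀ᶠ x in 𝓝 0, F x = 0 → a x = 0 := by
  obtain ⟨δ, hδ, hδe⟩ := Metric.eventually_nhds_iff.mp (hpc.continuousAt.eventually_ne he)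
  -- For `‖v‖ = 1` and `‖w‖ = R`, the vector `v + w • e` is `w` times a point at distance `δ / 2`
  -- from `e`, so `p` does not vanish there.
  set R : ℝ := 2 / δ with hRdef
  have hR : 0 < R := by positivity
  set K : Set E := (fun q : E × ℂ => q.1 + q.2 • e) ''
    (Metric.sphere (0 : E) 1 ×ˢ Metric.sphere (0 : ℂ) R) with hKdef
  set K' : Set E := (fun q : E × ℂ => q.1 + q.2 • e) ''
    (Metric.sphere (0 : E) 1 ×ˢ Metric.closedBall (0 : ℂ) R) with hK'def
  have hlin : Continuous fun q : E × ℂ => q.1 + q.2 • e := by fun_prop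
  have hK : IsCompact K := ((isCompact_sphere _ _).prod (isCompact_sphere _ _)).image hlin
  have hK' : IsCompact K' := ((isCompact_sphere _ _).prod (isCompact_closedBall _ _)).image hlin
  have hpK : ∀ x ∈ K, p x ≠ 0 := by
    rintro _ ⟨⟨v, w⟩, ⟨hv, hw⟩, rfl⟩
    rw [mem_sphere_zero_iff_norm] at hv hw
    have hw0 : w ≠ 0 := norm_pos_iff.mp (hw ▸ hR)
    have h1 : v + w • e = w • (e + w⁻¹ • v) := by
      rw [smul_add, smul_smul, mul_inv_cancel₀ hw0, one_smul, add_comm]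
    simp only
    rw [h1, hp]
    refine mul_ne_zero (pow_ne_zero _ hw0) (hδe ?_)
    simp only at hv hw
    rw [dist_eq_norm, add_sub_cancel_left, norm_smul, norm_inv, hv, hw, hRdef]
    field_simp
    norm_num
  have hF0 : F 0 = 0 := by
    have h := hF.def one_pos |>.self_of_nhds
    have h1 : p 0 = 0 := by have := hp 0 0; rwa [zero_smul, zero_pow hd, zero_mul] at this
    simpa [h1, hd] using h
  -- One `ε` serves all unit directions `v`, by compactness of `K` and boundedness of `K'`.
  obtain ⟨ε, hε, hall⟩ := Metric.eventually_nhds_iff.mp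
    ((eventually_ne_zero_of_isCompact hp hF hK hpc hpK).and
      ((eventually_forall_smul_of_isBounded hFa.eventually_analyticAt hK'.isBounded).and
        (eventually_forall_smul_of_isBounded haa.eventually_analyticAt hK'.isBounded)))
  refine Metric.eventually_nhds_iff.mpr ⟨ε, hε, fun x hx hFx => ?_⟩
  by_cases hx0 : x = 0
  · obtain ⟨C, hC⟩ := hflat 1
    have := hC.self_of_nhds hF0
    rw [hx0]
    simpa using this
  rw [dist_zero_right] at hx
  have hxn : (‖x‖ : ℂ) ≠ 0 := by simpa using hx0
  -- The point `x` is the zero `w = 0` of the family `w ↦ F (τ • (v + w • e))` at parameter `τ =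
  -- ‖x‖`.
  set v : E := (‖x‖ : ℂ)⁻¹ • x with hv
  have hv1 : ‖v‖ = 1 := by
    rw [hv, norm_smul, norm_inv, Complex.norm_real, norm_norm]
    exact inv_mul_cancel₀ (norm_ne_zero_iff.mpr hx0)
  have hxv : (‖x‖ : ℂ) • (v + (0 : ℂ) • e) = x := by
    rw [zero_smul, add_zero, hv, smul_smul, mul_inv_cancel₀ hxn, one_smul]
  set U : Set ℂ := Metric.ball 0 ε \ {0} with hU
  have hUo : IsOpen U := Metric.isOpen_ball.sdiff isClosed_singleton
  have hcomp : ∀ h : E → ℂ, (∀ τ : ℂ, dist τ 0 < ε → ∀ x ∈ K', AnalyticAt ℂ h (τ • x)) →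
      ∀ τ ∈ U, ∀ w ∈ Metric.closedBall (0 : ℂ) R,
        AnalyticAt ℂ (fun q : ℂ × ℂ => h (q.1 • (v + q.2 • e))) (τ, w) := by
    intro h hh τ hτ w hw
    refine AnalyticAt.fun_comp (g := h) (f := fun q : ℂ × ℂ => q.1 • (v + q.2 • e))
      (hh τ hτ.1 _ ⟨(v, w), ⟨mem_sphere_zero_iff_norm.mpr hv1, hw⟩, rfl⟩) ?_
    exact analyticAt_fst.smul (analyticAt_const.add (analyticAt_snd.smul analyticAt_const))
  obtain ⟨m, hm, hsum⟩ := exists_multiset_zeros hUo hR (c := 0)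
    (Φ := fun q : ℂ × ℂ => F (q.1 • (v + q.2 • e))) (hcomp F fun τ hτ => (hall hτ).2.1)
    (fun τ hτ w hw => (hall hτ.1).1 hτ.2 _
      ⟨(v, w), ⟨mem_sphere_zero_iff_norm.mpr hv1, hw⟩, rfl⟩)
  obtain ⟨k, hk⟩ := exists_card_eq_of_differentiableOn (isPreconnected_ball_diff_zero ε)
    (hsum (fun _ => 1) fun _ _ _ _ => analyticAt_const)
  have hxU : (‖x‖ : ℂ) ∈ U := ⟨by simpa using hx, hxn⟩
  have h0m : (0 : ℂ) ∈ m ‖x‖ := by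
    rw [hm _ hxU]
    refine ⟨Metric.mem_closedBall_self hR.le, ?_⟩
    simp only [hxv, hFx]
  by_contra hax
  -- an interpolation polynomial separating `a x` from the other values
  set s : Finset ℂ := insert 0 ((m ‖x‖).map fun w => a ((‖x‖ : ℂ) • (v + w • e))).toFinset with hs
  set q : Polynomial ℂ := ∏ b ∈ s.erase (a x), (Polynomial.X - Polynomial.C b) with hq
  have hqe : ∀ z, q.eval z = ∏ b ∈ s.erase (a x), (z - b) := fun z => by
    simp [hq, Polynomial.eval_prod]
  have hq0 : q.eval 0 = 0 := by
    rw [hqe]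
    refine Finset.prod_eq_zero (i := 0) ?_ (sub_self 0)
    exact Finset.mem_erase.mpr ⟨Ne.symm hax, Finset.mem_insert_self _ _⟩
  have hqa : q.eval (a x) ≠ 0 := by
    rw [hqe]
    refine Finset.prod_ne_zero_iff.mpr fun b hb => sub_ne_zero.mpr ?_
    exact (Finset.ne_of_mem_erase hb).symm
  have hqb : ∀ w ∈ m ‖x‖, a ((‖x‖ : ℂ) • (v + w • e)) ≠ a x →
      q.eval (a ((‖x‖ : ℂ) • (v + w • e))) = 0 := by
    intro w hw hne
    rw [hqe]
    refine Finset.prod_eq_zero (i := a ((‖x‖ : ℂ) • (v + w • e))) ?_ (sub_self _)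
    refine Finset.mem_erase.mpr ⟨hne, Finset.mem_insert_of_mem ?_⟩
    rw [Multiset.mem_toFinset]
    exact Multiset.mem_map_of_mem (fun w => a ((‖x‖ : ℂ) • (v + w • e))) hw
  -- Divisibility by `X` lets `q ∘ a` inherit the flatness of `a`; this is why `0` was put among the
  -- roots of `q`.
  obtain ⟨q', hq'⟩ : Polynomial.X ∣ q := by
    rw [Polynomial.X_dvd_iff, Polynomial.coeff_zero_eq_eval_zero, hq0]
  have hqz : ∀ z, q.eval z = z * q'.eval z := fun z => by rw [hq']; simp
  obtain ⟨B, hB⟩ := (isCompact_closedBall (0 : ℂ) (‖a 0‖ + 1)).exists_bound_of_continuousOn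
    (f := fun z => q'.eval z) q'.continuous.continuousOn
  have hSd := hsum (fun r => q.eval (a (r.1 • (v + r.2 • e)))) (by
    intro τ hτ w hw
    exact AnalyticAt.fun_comp (g := fun z => q.eval z)
      (f := fun r : ℂ × ℂ => a (r.1 • (v + r.2 • e)))
      (AnalyticOnNhd.eval_polynomial q _ (Set.mem_univ _)) (hcomp a (fun τ hτ => (hall hτ).2.2) τ hτ w hw))
  have hzero := eq_zero_of_flat hSd (by
    intro n
    obtain ⟨C, hC⟩ := hflat n
    obtain ⟨D, hD0, hD⟩ := hK'.isBounded.exists_pos_norm_le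
    have hab : ∀ᶠ x in 𝓝 (0 : E), ‖a x‖ ≤ ‖a 0‖ + 1 := by
      have := haa.continuousAt.norm.eventually_lt_const (lt_add_one ‖a 0‖)
      filter_upwards [this] with x hx using hx.le
    refine ⟨k * (|C| * D ^ n * B), ?_⟩
    filter_upwards [mem_nhdsWithin_of_mem_nhds (eventually_forall_smul_of_isBounded hC hK'.isBounded),
      mem_nhdsWithin_of_mem_nhds (eventually_forall_smul_of_isBounded hab hK'.isBounded),
      mem_nhdsWithin_of_mem_nhds (Metric.ball_mem_nhds (0 : ℂ) hε), self_mem_nhdsWithin]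
      with τ h1 h2 h3 h4
    have hτU : τ ∈ U := ⟨h3, h4⟩
    have hterm : ∀ w ∈ m τ, ‖q.eval (a (τ • (v + w • e)))‖ ≤ |C| * D ^ n * B * ‖τ‖ ^ n := by
      intro w hw
      obtain ⟨hw1, hw2⟩ := (hm τ hτU w).mp hw
      have hmem : v + w • e ∈ K' := ⟨(v, w), ⟨mem_sphere_zero_iff_norm.mpr hv1, hw1⟩, rfl⟩
      have h5 := h1 _ hmem hw2
      have h6 := hB _ (mem_closedBall_zero_iff.mpr (h2 _ hmem))
      rw [hqz, norm_mul]
      have h7 : ‖a (τ • (v + w • e))‖ ≤ |C| * (‖τ‖ * D) ^ n := by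
        refine h5.trans ?_
        rw [norm_smul]
        gcongr
        · exact le_abs_self C
        · exact hD _ hmem
      calc _ ≤ (|C| * (‖τ‖ * D) ^ n) * B :=
            mul_le_mul h7 h6 (norm_nonneg _) (by positivity)
        _ = _ := by rw [mul_pow]; ring
    have h8 := Multiset.le_sum_of_subadditive (fun z : ℂ => ‖z‖) norm_zero.le
      (fun x y => norm_add_le x y) ((m τ).map fun w => q.eval (a (τ • (v + w • e))))
    refine h8.trans ?_
    rw [Multiset.map_map]
    have h9 := Multiset.sum_le_card_nsmul
      ((m τ).map ((fun z : ℂ => ‖z‖) ∘ fun w => q.eval (a (τ • (v + w • e)))))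
      (|C| * D ^ n * B * ‖τ‖ ^ n) (by
        intro y hy
        obtain ⟨w, hw, rfl⟩ := Multiset.mem_map.mp hy
        exact hterm w hw)
    refine h9.trans_eq ?_
    rw [Multiset.card_map, hk τ hτU, nsmul_eq_mul]
    ring) _ hxU
  -- At `τ = ‖x‖` the sum counts the zeros where `a` takes the value `a x`, weighted by the nonzero
  -- `q (a x)`. It vanishes by flatness, yet `w = 0` is counted.
  have hcount : ((m ‖x‖).map fun w => q.eval (a ((‖x‖ : ℂ) • (v + w • e)))).sum =
      ((m ‖x‖).filter fun w => a ((‖x‖ : ℂ) • (v + w • e)) = a x).card * q.eval (a x) := by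
    refine Multiset.sum_map_eq_card_filter_mul _ (fun w _ h => by rw [h]) hqb
  rw [hcount, mul_eq_zero, or_iff_left hqa, Nat.cast_eq_zero, Multiset.card_eq_zero,
    Multiset.filter_eq_nil] at hzero
  exact hzero 0 h0m (by rw [hxv])

/-! ### Splitting plane curve germs by tangent direction. -/

theorem Multiset.prod_map_sub_eq_sum_esymm (s : Multiset ℂ) (y : ℂ) :
    (s.map fun x => y - x).prod =
      ∑ j ∈ Finset.range (s.card + 1), (-1) ^ j * (s.esymm j * y ^ (s.card - j)) := by
  have h := congrArg (Polynomial.eval y) (Multiset.prod_X_sub_X_eq_sum_esymm s)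
  rw [Polynomial.eval_multiset_prod, Multiset.map_map] at h
  simpa [Polynomial.eval_finsetSum, Function.comp_def] using h

/-- Elementary symmetric functions are holomorphic on a punctured neighbourhood and extend
continuously when the power sums are holomorphic and tend to zero. -/
theorem differentiableOn_esymm_and_tendsto {U : Set ℂ} {l : Filter ℂ} {M : ℂ → Multiset ℂ}
    (hd : ∀ j : ℕ, 0 < j → DifferentiableOn ℂ (fun s => ((M s).map fun x => x ^ j).sum) U)
    (ht : ∀ j : ℕ, 0 < j → Tendsto (fun s => ((M s).map fun x => x ^ j).sum) l (𝓝 0)) (j : ℕ) :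
    DifferentiableOn ℂ (fun s => (M s).esymm j) U ∧
      Tendsto (fun s => (M s).esymm j) l (𝓝 (if j = 0 then 1 else 0)) := by
  induction j using Nat.strong_induction_on with
  | _ j ih =>
    rcases Nat.eq_zero_or_pos j with rfl | hj
    · simp only [Multiset.esymm, Multiset.powersetCard_zero_left, Multiset.map_singleton,
        Multiset.prod_zero, Multiset.sum_singleton, if_true]
      exact ⟨differentiableOn_const _, tendsto_const_nhds⟩
    have hj' : (j : ℂ) ≠ 0 := Nat.cast_ne_zero.mpr hj.ne'
    have heq : (fun s => (M s).esymm j) = fun s => (j : ℂ)⁻¹ * ((-1) ^ (j + 1) *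
        ∑ a ∈ Finset.HasAntidiagonal.antidiagonal j with a.1 < j,
          (-1) ^ a.1 * (M s).esymm a.1 * ((M s).map fun x => x ^ a.2).sum) := by
      funext s
      rw [← Multiset.mul_esymm_eq_sum, inv_mul_cancel_left₀ hj']
    have hlt : ∀ a ∈ (Finset.HasAntidiagonal.antidiagonal j).filter (fun a => a.1 < j),
        a.1 < j ∧ 0 < a.2 := by
      intro a ha
      rw [Finset.mem_filter, Finset.HasAntidiagonal.mem_antidiagonal] at ha
      omega
    rw [heq, if_neg hj.ne']
    constructor
    · refine DifferentiableOn.const_mul (DifferentiableOn.const_mul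
        (DifferentiableOn.fun_sum fun a ha => ?_) _) _
      exact ((ih a.1 (hlt a ha).1).1.const_mul _).mul (hd a.2 (hlt a ha).2)
    · have : Tendsto (fun s => (j : ℂ)⁻¹ * ((-1) ^ (j + 1) *
        ∑ a ∈ Finset.HasAntidiagonal.antidiagonal j with a.1 < j,
          (-1) ^ a.1 * (M s).esymm a.1 * ((M s).map fun x => x ^ a.2).sum)) l
          (𝓝 ((j : ℂ)⁻¹ * ((-1) ^ (j + 1) *
            ∑ a ∈ Finset.HasAntidiagonal.antidiagonal j with a.1 < j,
              (-1) ^ a.1 * (if a.1 = 0 then 1 else 0) * 0))) := by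
        refine Tendsto.const_mul _ (Tendsto.const_mul _ (tendsto_finsetSum _ fun a ha => ?_))
        exact ((ih a.1 (hlt a ha).1).2.const_mul _).mul (ht a.2 (hlt a ha).2)
      simpa using this

theorem norm_multiset_sum_map_le {α : Type*} {g : α → ℂ} {B : ℝ} (s : Multiset α)
    (h : ∀ x ∈ s, ‖g x‖ ≤ B) : ‖(s.map g).sum‖ ≤ s.card * B := by
  induction s using Multiset.induction_on with
  | empty => simp
  | cons x s ih =>
    rw [Multiset.map_cons, Multiset.sum_cons, Multiset.card_cons]
    push_cast
    have h1 := ih fun y hy => h y (Multiset.mem_cons_of_mem hy)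
    have h2 := h x (Multiset.mem_cons_self x s)
    have h3 := norm_add_le (g x) (s.map g).sum
    linarith

section
variable {f p : ℂ × ℂ → ℂ} {d : ℕ}

/-- The part of a plane curve germ lying in a cone around an isolated tangent direction is
analytic. -/
theorem exists_analyticAt_cone (hd : d ≠ 0)
    (hp : ∀ (c : ℂ) x, p (c • x) = c ^ d * p x) (hfa : AnalyticAt ℂ f 0)
    (hf : (fun x => f x - p x) =o[𝓝 0] fun x => ‖x‖ ^ d)
    (hpa : ∀ x, AnalyticAt ℂ p x) {a : ℂ} {r : ℝ} (hr : 0 < r) (ha : p (1, a) = 0)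
    (hs : ∀ w ∈ Metric.sphere a r, p (1, w) ≠ 0) :
    ∃ Λ : ℂ × ℂ → ℂ, AnalyticAt ℂ Λ 0 ∧
      (∀ᶠ u in 𝓝 (0 : ℂ × ℂ), Λ u = 0 ↔ f u = 0 ∧ ‖u.2 - a * u.1‖ ≤ r * ‖u.1‖) ∧
      ∃ᶠ s in 𝓝[≠] (0 : ℂ), ∃ w ∈ Metric.ball a r, f (s, s * w) = 0 := by
  have hpc : Continuous p := continuous_iff_continuousAt.mpr fun x => (hpa x).continuousAt
  set K : Set (ℂ × ℂ) := (fun w : ℂ => ((1 : ℂ), w)) '' Metric.sphere a r with hKdef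
  set K' : Set (ℂ × ℂ) := (fun w : ℂ => ((1 : ℂ), w)) '' Metric.closedBall a r with hK'def
  have hlin : Continuous fun w : ℂ => ((1 : ℂ), w) := by fun_prop
  have hK : IsCompact K := (isCompact_sphere _ _).image hlin
  have hK' : IsCompact K' := (isCompact_closedBall _ _).image hlin
  have hf0 : f 0 = 0 := by
    have h := hf.def one_pos |>.self_of_nhds
    have h1 : p 0 = 0 := by have := hp 0 0; rwa [zero_smul, zero_pow hd, zero_mul] at this
    simpa [h1, hd] using h
  have hnear : ∀ᶠ s in 𝓝 (0 : ℂ), s ≠ 0 → ∃ w ∈ Metric.ball a r, f (s, s * w) = 0 := by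
    have hpl : ∀ x, AnalyticAt ℂ (fun w : ℂ => p ((1, a) + w • (0, 1))) x := fun x =>
      AnalyticAt.fun_comp (g := p) (f := fun w : ℂ => ((1, a) + w • (0, 1) : ℂ × ℂ)) (hpa _)
        (analyticAt_const.add (analyticAt_id.smul analyticAt_const))
    have h := eventually_exists_zero_near (v := (1, a)) (e := (0, 1)) hp hfa hf hpc ha
      (hpl 0) (by
        intro hev
        have h1 := AnalyticOnNhd.eq_of_eventuallyEq (f := fun w : ℂ => p ((1, a) + w • (0, 1)))
          (g := fun _ => 0) (fun x _ => hpl x) (fun x _ => analyticAt_const) hev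
        obtain ⟨w, hw⟩ := (NormedSpace.sphere_nonempty (x := a)).mpr hr.le
        have h2 := congrFun h1 (w - a)
        simp only [Prod.smul_mk, mul_zero, smul_eq_mul, mul_one, Prod.mk_add_mk, add_zero,
          add_sub_cancel] at h2
        exact hs w hw h2) hr
    filter_upwards [h] with s h1 h0
    obtain ⟨w, hw, hfw⟩ := h1 h0
    refine ⟨a + w, by simpa [dist_eq_norm] using hw, ?_⟩
    simpa using hfw
  obtain ⟨ε, hε, hall⟩ := Metric.eventually_nhds_iff.mp
    ((eventually_ne_zero_of_isCompact hp hf hK hpc (by rintro _ ⟨w, hw, rfl⟩; exact hs w hw)).and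
      ((eventually_forall_smul_of_isBounded hfa.eventually_analyticAt hK'.isBounded).and hnear))
  set U : Set ℂ := Metric.ball 0 ε \ {0} with hU
  have hUo : IsOpen U := Metric.isOpen_ball.sdiff isClosed_singleton
  have hUn : U ∈ 𝓝[≠] (0 : ℂ) := by
    refine mem_nhdsWithin.mpr ⟨Metric.ball 0 ε, Metric.isOpen_ball, Metric.mem_ball_self hε, ?_⟩
    exact fun x hx => hx
  have hsm : ∀ s w : ℂ, s • ((1 : ℂ), w) = (s, s * w) := fun s w => by simp
  obtain ⟨m, hm, hsum⟩ := exists_multiset_zeros hUo hr (c := a)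
    (Φ := fun q : ℂ × ℂ => f (q.1, q.1 * q.2)) (by
      intro τ hτ w hw
      refine AnalyticAt.fun_comp (g := f) (f := fun q : ℂ × ℂ => (q.1, q.1 * q.2)) ?_
        (analyticAt_fst.prod (analyticAt_fst.mul analyticAt_snd))
      have := (hall hτ.1).2.1 _ ⟨w, hw, rfl⟩
      rwa [hsm] at this)
    (fun τ hτ w hw => by
      have := (hall hτ.1).1 hτ.2 _ ⟨w, hw, rfl⟩
      rwa [hsm] at this)
  obtain ⟨k, hk⟩ := exists_card_eq_of_differentiableOn (isPreconnected_ball_diff_zero ε)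
    (hsum (fun _ => 1) fun _ _ _ _ => analyticAt_const)
  -- Positive degree is needed so that on the axis `s = 0` the Weierstrass polynomial `y ^ k`
  -- vanishes only at the origin.
  have hkpos : 0 < k := by
    have hτ : ((ε / 2 : ℝ) : ℂ) ∈ U := by
      refine ⟨?_, ?_⟩
      · rw [Metric.mem_ball, dist_zero_right, Complex.norm_real, Real.norm_of_nonneg (by positivity)]
        linarith
      · simp only [Set.mem_singleton_iff, Complex.ofReal_eq_zero]
        positivity
    obtain ⟨w, hw, hfw⟩ := (hall hτ.1).2.2 hτ.2
    rw [← hk _ hτ, Multiset.card_pos_iff_exists_mem]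
    exact ⟨w, (hm _ hτ w).mpr ⟨Metric.ball_subset_closedBall hw, hfw⟩⟩
  set M : ℂ → Multiset ℂ := fun s => (m s).map fun w => s * w with hM
  have hMc : ∀ s ∈ U, (M s).card = k := fun s hs => by simp [hM, hk s hs]
  have hpow : ∀ j : ℕ, (fun s => ((M s).map fun x => x ^ j).sum) =
      fun s => ((m s).map fun w => (s * w) ^ j).sum := fun j => by
    funext s; simp [hM, Multiset.map_map]
  have hes := differentiableOn_esymm_and_tendsto (U := U) (l := 𝓝[≠] (0 : ℂ)) (M := M)
    (fun j _ => by
      rw [hpow]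
      exact hsum (fun q => (q.1 * q.2) ^ j) fun _ _ _ _ =>
        (analyticAt_fst.mul analyticAt_snd).pow j)
    (fun j hj => by
      rw [hpow]
      refine squeeze_zero_norm' (a := fun s : ℂ => k * (‖s‖ * (‖a‖ + r)) ^ j) ?_ ?_
      · filter_upwards [hUn] with s hs
        refine (norm_multiset_sum_map_le (B := (‖s‖ * (‖a‖ + r)) ^ j) (m s) fun w hw => ?_).trans_eq
          (by rw [hk s hs])
        rw [norm_pow, norm_mul]
        have h1 : ‖w‖ ≤ ‖a‖ + r := by
          have := ((hm s hs w).mp hw).1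
          rw [Metric.mem_closedBall, dist_eq_norm] at this
          have h2 := norm_le_norm_add_norm_sub' w a
          linarith
        gcongr
      · have : Tendsto (fun s : ℂ => k * (‖s‖ * (‖a‖ + r)) ^ j) (𝓝 0)
            (𝓝 (k * (‖(0 : ℂ)‖ * (‖a‖ + r)) ^ j)) := Continuous.tendsto (by fun_prop) 0
        simp only [norm_zero, zero_mul, zero_pow hj.ne', mul_zero] at this
        exact this.mono_left nhdsWithin_le_nhds)
  -- The roots `s * w` tend to zero with `s`, so the coefficients extend over `s = 0` with the
  -- values of those of `y ^ k`.
  set e : ℕ → ℂ → ℂ := fun j => Function.update (fun s => (M s).esymm j) 0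
    (if j = 0 then 1 else 0) with he
  have hea : ∀ j, AnalyticAt ℂ (e j) 0 := by
    intro j
    refine Complex.analyticAt_of_differentiable_on_punctured_nhds_of_continuousAt ?_ ?_
    · filter_upwards [hUn] with s hs
      refine (((hes j).1 s hs).differentiableAt (hUo.mem_nhds hs)).congr_of_eventuallyEq ?_
      filter_upwards [hUo.mem_nhds hs] with x hx using Function.update_of_ne hx.2 _ _
    · exact continuousAt_update_same.mpr (hes j).2
  set Λ : ℂ × ℂ → ℂ := fun u => ∑ j ∈ Finset.range (k + 1), (-1) ^ j * (e j u.1 * u.2 ^ (k - j))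
    with hΛ
  have hΛU : ∀ s ∈ U, ∀ y, Λ (s, y) = ((M s).map fun x => y - x).prod := by
    intro s hs y
    rw [Multiset.prod_map_sub_eq_sum_esymm, hMc s hs]
    refine Finset.sum_congr rfl fun j _ => ?_
    rw [he]
    simp only [Function.update_of_ne hs.2]
  have hΛ0 : ∀ y, Λ (0, y) = y ^ k := by
    intro y
    rw [hΛ]
    simp only [he, Function.update_self]
    rw [Finset.sum_eq_single 0]
    · simp
    · intro j _ hj; simp [hj]
    · simp
  refine ⟨Λ, ?_, ?_, ?_⟩
  · refine Finset.analyticAt_fun_sum _ fun j _ => analyticAt_const.mul (AnalyticAt.mul ?_ (analyticAt_snd.pow _))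
    exact AnalyticAt.fun_comp (g := e j) (f := fun u : ℂ × ℂ => u.1) (hea j) analyticAt_fst
  · have hev : ∀ᶠ u in 𝓝 (0 : ℂ × ℂ), u.1 ∈ Metric.ball (0 : ℂ) ε :=
      continuous_fst.continuousAt.eventually_mem (Metric.ball_mem_nhds (0 : ℂ) hε)
    filter_upwards [hev] with u hu
    obtain ⟨s, y⟩ := u
    by_cases h0 : s = 0
    · subst h0
      rw [hΛ0, pow_eq_zero_iff hkpos.ne']
      constructor
      · rintro rfl
        exact ⟨hf0, by simp⟩
      · rintro ⟨-, h⟩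
        simpa using h
    · have hsU : s ∈ U := ⟨hu, h0⟩
      have hkey : ∀ w : ℂ, ‖s * w - a * s‖ ≤ r * ‖s‖ ↔ w ∈ Metric.closedBall a r := by
        intro w
        rw [Metric.mem_closedBall, dist_eq_norm, mul_comm s w, ← sub_mul, norm_mul]
        exact mul_le_mul_iff_of_pos_right (norm_pos_iff.mpr h0)
      rw [hΛU s hsU, Multiset.prod_eq_zero_iff]
      simp only [hM, Multiset.map_map, Multiset.mem_map, Function.comp_apply]
      constructor
      · rintro ⟨w, hw, hyw⟩
        rw [sub_eq_zero] at hyw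
        obtain ⟨h1, h2⟩ := (hm s hsU w).mp hw
        rw [hyw]
        exact ⟨h2, (hkey w).mpr h1⟩
      · rintro ⟨h1, h2⟩
        have hyw : y = s * (y / s) := by field_simp
        refine ⟨y / s, (hm s hsU _).mpr ⟨(hkey _).mp (by rw [← hyw]; exact h2), ?_⟩, ?_⟩
        · simp only [← hyw, h1]
        · rw [← hyw, sub_self]
  · refine Eventually.frequently ?_
    filter_upwards [mem_nhdsWithin_of_mem_nhds hnear, self_mem_nhdsWithin] with s h1 h2 using h1 h2

/-- A plane curve germ with two different tangent lines is the union of two smaller germs. -/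
theorem exists_analyticAt_decomposition (hd : d ≠ 0)
    (hp : ∀ (c : ℂ) x, p (c • x) = c ^ d * p x) (hfa : AnalyticAt ℂ f 0)
    (hf : (fun x => f x - p x) =o[𝓝 0] fun x => ‖x‖ ^ d)
    (hpa : ∀ x, AnalyticAt ℂ p x) {N : Polynomial ℂ} (hN : N ≠ 0)
    (hpN : ∀ t, p (1, t) = N.eval t) (h01 : p (0, 1) ≠ 0) {a₁ a₂ : ℂ} (h₁ : N.IsRoot a₁)
    (h₂ : N.IsRoot a₂) (hne : a₁ ≠ a₂) :
    ∃ Λ₁ Λ₂ : ℂ × ℂ → ℂ, AnalyticAt ℂ Λ₁ 0 ∧ AnalyticAt ℂ Λ₂ 0 ∧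
      (∀ᶠ u in 𝓝 (0 : ℂ × ℂ), f u = 0 ↔ Λ₁ u = 0 ∨ Λ₂ u = 0) ∧
      (¬ ∀ᶠ u in 𝓝 (0 : ℂ × ℂ), f u = 0 → Λ₁ u = 0) ∧
      ¬ ∀ᶠ u in 𝓝 (0 : ℂ × ℂ), f u = 0 → Λ₂ u = 0 := by
  have hpc : Continuous p := continuous_iff_continuousAt.mpr fun x => (hpa x).continuousAt
  set S : Finset ℂ := N.roots.toFinset with hS
  have hSr : ∀ a, a ∈ S ↔ N.eval a = 0 := fun a => by
    rw [hS, Multiset.mem_toFinset, Polynomial.mem_roots hN]; rfl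
  have h₁S : a₁ ∈ S := (hSr _).mpr h₁
  have h₂S : a₂ ∈ S := (hSr _).mpr h₂
  obtain ⟨r, hr, hrS⟩ : ∃ r : ℝ, 0 < r ∧ ∀ a ∈ S, ∀ b ∈ S, a ≠ b → 2 * r < dist a b := by
    have hpos : 0 < (S : Set ℂ).infsep :=
      S.finite_toSet.infsep_pos_iff_nontrivial.mpr ⟨a₁, h₁S, a₂, h₂S, hne⟩
    -- A quarter of the least distance leaves the strict inequality that makes the closed cones
    -- disjoint away from the origin.
    refine ⟨(S : Set ℂ).infsep / 4, by positivity, fun a ha b hb hab => ?_⟩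
    have := Set.infsep_le_dist_of_mem (s := (S : Set ℂ)) ha hb hab
    linarith
  have hcone : ∀ a ∈ S, ∃ Λ : ℂ × ℂ → ℂ, AnalyticAt ℂ Λ 0 ∧
      (∀ᶠ u in 𝓝 (0 : ℂ × ℂ), Λ u = 0 ↔ f u = 0 ∧ ‖u.2 - a * u.1‖ ≤ r * ‖u.1‖) ∧
      ∃ᶠ s in 𝓝[≠] (0 : ℂ), ∃ w ∈ Metric.ball a r, f (s, s * w) = 0 := by
    intro a ha
    refine exists_analyticAt_cone hd hp hfa hf hpa hr (by rw [hpN, (hSr a).mp ha]) fun w hw h0 => ?_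
    rw [Metric.mem_sphere] at hw
    have hwa : w ≠ a := by rintro rfl; rw [dist_self] at hw; exact hr.ne hw
    have := hrS w ((hSr w).mpr (by rw [← hpN, h0])) a ha hwa
    linarith
  choose! Λ hΛa hΛz hΛn using hcone
  have hsep : ∀ a ∈ S, ∀ b ∈ S, a ≠ b → ∀ s : ℂ, s ≠ 0 → ∀ w ∈ Metric.ball a r,
      ¬ ‖s * w - b * s‖ ≤ r * ‖s‖ := by
    intro a ha b hb hab s hs w hw hle
    rw [mul_comm s w, ← sub_mul, norm_mul, mul_le_mul_iff_of_pos_right (norm_pos_iff.mpr hs),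
      ← dist_eq_norm] at hle
    have h1 := hrS a ha b hb hab
    have h2 := dist_triangle_left a b w
    rw [Metric.mem_ball] at hw
    linarith
  -- The curve has points arbitrarily near the origin inside the cone around `a`, and the disjoint
  -- cones around `T` miss them.
  have hnot : ∀ a ∈ S, ∀ T : Finset ℂ, T ⊆ S → a ∉ T →
      ¬ ∀ᶠ u in 𝓝 (0 : ℂ × ℂ), f u = 0 → ∃ b ∈ T, Λ b u = 0 := by
    intro a ha T hT haT hev
    have hall : ∀ᶠ u in 𝓝 (0 : ℂ × ℂ), ∀ b ∈ T,
        Λ b u = 0 ↔ f u = 0 ∧ ‖u.2 - b * u.1‖ ≤ r * ‖u.1‖ :=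
      (Finset.eventually_all T).mpr fun b hb => hΛz b (hT hb)
    have hb : Bornology.IsBounded ((fun w : ℂ => ((1 : ℂ), w)) '' Metric.closedBall a r) :=
      ((isCompact_closedBall a r).image (by fun_prop)).isBounded
    have hsm := eventually_forall_smul_of_isBounded (hev.and hall) hb
    obtain ⟨s, ⟨w, hw, hfw⟩, h1, h2⟩ := ((hΛn a ha).and_eventually
      (Filter.Eventually.and (mem_nhdsWithin_of_mem_nhds hsm) self_mem_nhdsWithin)).exists
    have h3 := h1 _ ⟨w, Metric.ball_subset_closedBall hw, rfl⟩
    simp only [Prod.smul_mk, smul_eq_mul, mul_one] at h3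
    obtain ⟨b, hbT, hb0⟩ := h3.1 hfw
    have h4 := ((h3.2 b hbT).mp hb0).2
    exact hsep a ha b (hT hbT) (fun h => haT (h ▸ hbT)) s h2 w hw h4
  -- Outside the open cones the unit sphere is compact and free of zeros of `p`; on the vertical
  -- direction this is `h01`. Hence nearby zeros of `f` lie in the cones.
  have hcover : ∀ᶠ u in 𝓝 (0 : ℂ × ℂ), f u = 0 → ∃ a ∈ S, ‖u.2 - a * u.1‖ ≤ r * ‖u.1‖ := by
    set K : Set (ℂ × ℂ) := {u | u ∈ Metric.sphere 0 1 ∧ ∀ a ∈ S, r * ‖u.1‖ ≤ ‖u.2 - a * u.1‖}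
      with hK
    have hKc : IsCompact K := by
      refine (isCompact_sphere (0 : ℂ × ℂ) 1).inter_right (t := {u | ∀ a ∈ S, r * ‖u.1‖ ≤ ‖u.2 - a * u.1‖}) ?_
      have : {u : ℂ × ℂ | ∀ a ∈ S, r * ‖u.1‖ ≤ ‖u.2 - a * u.1‖} =
          ⋂ a ∈ S, {u : ℂ × ℂ | r * ‖u.1‖ ≤ ‖u.2 - a * u.1‖} := by ext; simp
      rw [this]
      exact isClosed_biInter fun a _ => isClosed_le (by fun_prop) (by fun_prop)
    have hKp : ∀ u ∈ K, p u ≠ 0 := by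
      rintro ⟨s, y⟩ ⟨hu, hua⟩ h0
      by_cases hs : s = 0
      · subst hs
        have hy : y ≠ 0 := by
          rintro rfl
          simp at hu
        have h1 : ((0 : ℂ), y) = y • ((0 : ℂ), (1 : ℂ)) := by simp
        rw [h1, hp] at h0
        exact mul_ne_zero (pow_ne_zero _ hy) h01 h0
      · have h1 : (s, y) = s • ((1 : ℂ), y / s) := by
          simp only [Prod.smul_mk, smul_eq_mul, mul_one]
          rw [mul_div_cancel₀ _ hs]
        rw [h1, hp, mul_eq_zero, or_iff_right (pow_ne_zero _ hs), hpN] at h0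
        have h2 := hua _ ((hSr _).mpr h0)
        simp only [div_mul_cancel₀ _ hs, sub_self, norm_zero] at h2
        have : 0 < r * ‖s‖ := mul_pos hr (norm_pos_iff.mpr hs)
        linarith
    obtain ⟨ε, hε, hall⟩ := Metric.eventually_nhds_iff.mp
      (eventually_ne_zero_of_isCompact hp hf hKc hpc hKp)
    refine Metric.eventually_nhds_iff.mpr ⟨ε, hε, fun u hu hfu => ?_⟩
    by_cases hu0 : u = 0
    · exact ⟨a₁, h₁S, by simp [hu0]⟩
    by_contra! hno
    rw [dist_zero_right] at hu
    have hun : (‖u‖ : ℂ) ≠ 0 := by simpa using hu0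
    have huv : (‖u‖ : ℂ) • ((‖u‖ : ℂ)⁻¹ • u) = u := by
      rw [smul_smul, mul_inv_cancel₀ hun, one_smul]
    refine hall (y := (‖u‖ : ℂ)) (by simpa using hu) hun ((‖u‖ : ℂ)⁻¹ • u) ⟨?_, fun a ha => ?_⟩
      (by rw [huv, hfu])
    · rw [mem_sphere_zero_iff_norm, norm_smul, norm_inv, Complex.norm_real, norm_norm]
      exact inv_mul_cancel₀ (norm_ne_zero_iff.mpr hu0)
    · have h1 := (hno a ha).le
      have h2 : ((‖u‖ : ℂ)⁻¹ • u).2 - a * ((‖u‖ : ℂ)⁻¹ • u).1 = (‖u‖ : ℂ)⁻¹ * (u.2 - a * u.1) := by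
        simp only [Prod.smul_fst, Prod.smul_snd, smul_eq_mul]; ring
      rw [h2, Prod.smul_fst, smul_eq_mul, norm_mul, norm_mul, mul_left_comm]
      exact mul_le_mul_of_nonneg_left h1 (norm_nonneg _)
  have hallS : ∀ᶠ u in 𝓝 (0 : ℂ × ℂ), ∀ b ∈ S,
      Λ b u = 0 ↔ f u = 0 ∧ ‖u.2 - b * u.1‖ ≤ r * ‖u.1‖ :=
    (Finset.eventually_all S).mpr fun b hb => hΛz b hb
  refine ⟨Λ a₁, fun u => ∏ a ∈ S.erase a₁, Λ a u, hΛa a₁ h₁S,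
    Finset.analyticAt_fun_prod _ fun a ha => hΛa a (Finset.mem_of_mem_erase ha), ?_, ?_, ?_⟩
  · filter_upwards [hallS, hcover] with u h1 h2
    rw [Finset.prod_eq_zero_iff]
    constructor
    · intro hfu
      obtain ⟨a, ha, hle⟩ := h2 hfu
      have h3 := (h1 a ha).mpr ⟨hfu, hle⟩
      by_cases haa : a = a₁
      · exact Or.inl (haa ▸ h3)
      · exact Or.inr ⟨a, Finset.mem_erase.mpr ⟨haa, ha⟩, h3⟩
    · rintro (h | ⟨a, ha, h⟩)
      · exact ((h1 a₁ h₁S).mp h).1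
      · exact ((h1 a (Finset.mem_of_mem_erase ha)).mp h).1
  · intro hev
    refine hnot a₂ h₂S {a₁} (by simpa using h₁S) (by simpa using hne.symm) ?_
    filter_upwards [hev] with u hu hfu using ⟨a₁, Finset.mem_singleton_self _, hu hfu⟩
  · intro hev
    refine hnot a₁ h₁S (S.erase a₁) (Finset.erase_subset _ _) (Finset.notMem_erase _ _) ?_
    filter_upwards [hev] with u hu hfu
    exact Finset.prod_eq_zero_iff.mp (hu hfu)

end

/-! ### Restricting forms to lines. -/

theorem eval_restrictToLine (P : MvPolynomial (Fin 3) ℂ) (p q : Fin 3 → ℂ) (t : ℂ) :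
    (restrictToLine P p q).eval t = MvPolynomial.eval (p + t • q) P := by
  rw [restrictToLine, ← Polynomial.coe_evalRingHom, MvPolynomial.map_aeval,
    MvPolynomial.eval, MvPolynomial.coe_eval₂Hom]
  congr 1
  · ext; simp
  · funext i; simp; ring

theorem eval_smul_of_isHomogeneous {P : MvPolynomial (Fin 3) ℂ} {d : ℕ} (hP : P.IsHomogeneous d)
    (c : ℂ) (x : Fin 3 → ℂ) :
    MvPolynomial.eval (c • x) P = c ^ d * MvPolynomial.eval x P := by
  rw [MvPolynomial.eval_eq, MvPolynomial.eval_eq, Finset.mul_sum]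
  refine Finset.sum_congr rfl fun m hm => ?_
  have hdeg := hP.degree_eq_sum_deg_support hm
  simp only [Pi.smul_apply, smul_eq_mul, mul_pow]
  rw [Finset.prod_mul_distrib, Finset.prod_pow_eq_pow_sum, ← hdeg]
  ring

theorem restrictToLine_add_smul (P : MvPolynomial (Fin 3) ℂ) (p q : Fin 3 → ℂ) (a : ℂ) :
    restrictToLine P (p + a • q) q = (restrictToLine P p q).comp (Polynomial.X + Polynomial.C a) := by
  refine Polynomial.funext fun t => ?_
  rw [Polynomial.eval_comp, eval_restrictToLine, eval_restrictToLine]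
  simp only [Polynomial.eval_add, Polynomial.eval_X, Polynomial.eval_C]
  congr 2
  rw [add_smul, add_assoc, add_comm (a • q)]

theorem linearIndependent_add_smul {p q : Fin 3 → ℂ} (h : LinearIndependent ℂ ![p, q]) (a : ℂ) :
    LinearIndependent ℂ ![p + a • q, q] := by
  rw [LinearIndependent.pair_iff] at h ⊢
  intro s t hst
  have := h s (s * a + t) (by rw [← hst]; module)
  obtain ⟨h1, h2⟩ := this
  subst h1
  exact ⟨rfl, by simpa using h2⟩

theorem restrictToLine_ne_zero {P : MvPolynomial (Fin 3) ℂ} (hfl : ¬ HasHyperflex P)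
    {p q : Fin 3 → ℂ} (h : LinearIndependent ℂ ![p, q]) : restrictToLine P p q ≠ 0 :=
  fun h0 => hfl ⟨p, q, h, h0 ▸ dvd_zero _⟩

/-- A form of degree at least four without hyperflexes has two different zeros on each line. -/
theorem exists_two_roots_restrictToLine {P : MvPolynomial (Fin 3) ℂ} {d : ℕ}
    (hP : P.IsHomogeneous d) (hd : 4 ≤ d) (hfl : ¬ HasHyperflex P) {e₁ e₂ : Fin 3 → ℂ}
    (he : LinearIndependent ℂ ![e₁, e₂]) (hPe : MvPolynomial.eval e₂ P ≠ 0) :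
    ∃ a₁ a₂, (restrictToLine P e₁ e₂).IsRoot a₁ ∧ (restrictToLine P e₁ e₂).IsRoot a₂ ∧ a₁ ≠ a₂ := by
  by_contra! hno
  set N := restrictToLine P e₁ e₂ with hN
  have hN0 : N ≠ 0 := restrictToLine_ne_zero hfl he
  obtain ⟨a, ha⟩ : ∃ a, ∀ b ∈ N.roots, b = a := by
    by_cases h : ∃ a, a ∈ N.roots
    · obtain ⟨a, ha⟩ := h
      refine ⟨a, fun b hb => ?_⟩
      exact hno b a ((Polynomial.mem_roots hN0).mp hb) ((Polynomial.mem_roots hN0).mp ha)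
    · push Not at h
      exact ⟨0, fun b hb => absurd hb (h b)⟩
  have hrep : N.roots = Multiset.replicate N.roots.card a := Multiset.eq_replicate_card.mpr ha
  set n := N.roots.card with hn
  have hfac : N = Polynomial.C N.leadingCoeff * (Polynomial.X - Polynomial.C a) ^ n := by
    have h := (IsAlgClosed.splits N).eq_prod_roots
    rw [hrep, Multiset.map_replicate, Multiset.prod_replicate] at h
    exact h
  -- A single root `a` of multiplicity at least four is a hyperflex at `e₁ + a • e₂`.
  have hn3 : n < 4 := by
    by_contra! h4
    refine hfl ⟨e₁ + a • e₂, e₂, linearIndependent_add_smul he a, ?_⟩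
    rw [restrictToLine_add_smul, ← hN, hfac]
    simp only [Polynomial.mul_comp, Polynomial.pow_comp, Polynomial.sub_comp, Polynomial.X_comp,
      Polynomial.C_comp, add_sub_cancel_right]
    exact (pow_dvd_pow _ h4).mul_left _
  -- Seen from `e₂`, the missing degree `d - n > 0` becomes a zero at `e₂` itself, where `P` does
  -- not vanish.
  have hrev : restrictToLine P e₂ e₁ = Polynomial.C N.leadingCoeff * Polynomial.X ^ (d - n) *
      (1 - Polynomial.C a * Polynomial.X) ^ n := by
    refine Polynomial.eq_of_infinite_eval_eq _ _ (Set.Infinite.mono (s := {0}ᶜ) ?_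
      (Set.finite_singleton (0 : ℂ)).infinite_compl)
    intro T hT
    have hT : T ≠ 0 := hT
    have h1 : e₂ + T • e₁ = T • (e₁ + T⁻¹ • e₂) := by
      rw [smul_add, smul_smul, mul_inv_cancel₀ hT, one_smul, add_comm]
    change (restrictToLine P e₂ e₁).eval T = _
    rw [eval_restrictToLine, h1, eval_smul_of_isHomogeneous hP, ← eval_restrictToLine, ← hN, hfac]
    simp only [Polynomial.eval_mul, Polynomial.eval_C, Polynomial.eval_pow, Polynomial.eval_sub,
      Polynomial.eval_X, Polynomial.eval_one]
    have h2 : T ^ d = T ^ (d - n) * T ^ n := by rw [← pow_add]; congr 1; omega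
    have h3 : 1 - a * T = T * (T⁻¹ - a) := by field_simp
    rw [h2, h3, mul_pow, Polynomial.leadingCoeff_mul, Polynomial.leadingCoeff_C]
    simp only [(Polynomial.monic_X_sub_C a).pow n |>.leadingCoeff]
    ring
  apply hPe
  have h := eval_restrictToLine P e₂ e₁ 0
  rw [zero_smul, add_zero, hrev] at h
  rw [← h]
  have : d - n ≠ 0 := by omega
  simp [this]

/-! ### Sections by smooth surface germs. -/

theorem exists_basis_of_kernel {L : (Fin 3 → ℂ) →L[ℂ] ℂ} (hL : L ≠ 0) :
    ∃ p q e : Fin 3 → ℂ, LinearIndependent ℂ ![p, q] ∧ L p = 0 ∧ L q = 0 ∧ L e = 1 := by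
  obtain ⟨x, hx⟩ : ∃ x, L x ≠ 0 := by
    by_contra! h
    exact hL (ContinuousLinearMap.ext h)
  have hfr : Module.finrank ℂ (L : (Fin 3 → ℂ) →ₗ[ℂ] ℂ).ker = 2 := by
    have h1 := LinearMap.finrank_range_add_finrank_ker (L : (Fin 3 → ℂ) →ₗ[ℂ] ℂ)
    have h2 : (L : (Fin 3 → ℂ) →ₗ[ℂ] ℂ).range = ⊤ :=
      LinearMap.range_eq_top.mpr (LinearMap.surjective (by
        intro h; exact hx (LinearMap.congr_fun h x)))
    rw [h2, finrank_top, Module.finrank_self, Module.finrank_fin_fun] at h1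
    omega
  let b := Module.finBasisOfFinrankEq ℂ _ hfr
  have hli := b.linearIndependent.map' (Submodule.subtype _) (Submodule.ker_subtype _)
  refine ⟨b 0, b 1, (L x)⁻¹ • x, ?_, (b 0).2, (b 1).2, ?_⟩
  · have heq : ![(b 0 : Fin 3 → ℂ), b 1] = Submodule.subtype _ ∘ b := by
      ext i j
      fin_cases i <;> rfl
    rw [heq]
    exact hli
  · rw [map_smul, smul_eq_mul, inv_mul_cancel₀ hx]

/-- Homogeneity reduces the estimate to arguments of bounded size, where `p` is uniformly
continuous. This replaces a chart of `Y` by its linear part inside the initial form. -/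
theorem isLittleO_comp_homogeneous {E : Type*} [NormedAddCommGroup E] {p : (Fin 3 → ℂ) → ℂ} {d : ℕ}
    (hp : ∀ (c : ℂ) x, p (c • x) = c ^ d * p x) (hpc : Continuous p) {α β : E → Fin 3 → ℂ} {B : ℝ}
    (hβ : ∀ u, ‖β u‖ ≤ B * ‖u‖) (hαβ : (fun u => α u - β u) =o[𝓝 0] fun u => u)
    (h0 : α 0 = β 0) :
    (fun u => p (α u) - p (β u)) =o[𝓝 0] fun u => ‖u‖ ^ d := by
  have huc := (isCompact_closedBall (0 : Fin 3 → ℂ) (B + 1)).uniformContinuousOn_of_continuous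
    hpc.continuousOn
  rw [Metric.uniformContinuousOn_iff] at huc
  refine Asymptotics.isLittleO_iff.mpr fun η hη => ?_
  obtain ⟨δ, hδ, hδ'⟩ := huc η hη
  have hδ₁ : 0 < min (δ / 2) 1 := lt_min (half_pos hδ) one_pos
  filter_upwards [hαβ.def hδ₁] with u hu
  by_cases hu0 : u = 0
  · subst hu0; rw [h0, sub_self, norm_zero]; positivity
  have hn : 0 < ‖u‖ := norm_pos_iff.mpr hu0
  have hnc : (‖u‖ : ℂ) ≠ 0 := by exact_mod_cast hn.ne'
  have hsc : ∀ x : Fin 3 → ℂ, p x = (‖u‖ : ℂ) ^ d * p ((‖u‖ : ℂ)⁻¹ • x) := fun x => by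
    rw [← hp, smul_smul, mul_inv_cancel₀ hnc, one_smul]
  have hns : ∀ x : Fin 3 → ℂ, ‖(‖u‖ : ℂ)⁻¹ • x‖ = ‖x‖ / ‖u‖ := fun x => by
    rw [norm_smul, norm_inv, Complex.norm_real, norm_norm, inv_mul_eq_div]
  have h1 : ‖(‖u‖ : ℂ)⁻¹ • β u‖ ≤ B := by
    rw [hns, div_le_iff₀ hn]; exact hβ u
  have h2 : ‖(‖u‖ : ℂ)⁻¹ • α u - (‖u‖ : ℂ)⁻¹ • β u‖ ≤ min (δ / 2) 1 := by
    rw [← smul_sub, hns, div_le_iff₀ hn]; exact hu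
  have h3 : ‖(‖u‖ : ℂ)⁻¹ • α u‖ ≤ B + 1 := by
    have := norm_le_norm_add_norm_sub' ((‖u‖ : ℂ)⁻¹ • α u) ((‖u‖ : ℂ)⁻¹ • β u)
    have := h2.trans (min_le_right _ _)
    linarith
  have h4 := hδ' _ (mem_closedBall_zero_iff.mpr h3) _
    (mem_closedBall_zero_iff.mpr (h1.trans (by linarith))) (by
      rw [dist_eq_norm]
      have := h2.trans (min_le_left _ _)
      linarith)
  rw [dist_eq_norm] at h4
  rw [hsc (α u), hsc (β u), ← mul_sub, norm_mul, norm_pow, Complex.norm_real, norm_pow, norm_norm,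
    mul_comm]
  exact mul_le_mul_of_nonneg_right h4.le (by positivity)

/-- A form of degree at least four without hyperflexes is a tangent cone all of whose smooth
sections are reducible. -/
theorem allSmoothSectionsReducible_of_not_hasHyperflex {F : (Fin 3 → ℂ) → ℂ} {d : ℕ}
    {P : MvPolynomial (Fin 3) ℂ} (hFa : AnalyticAt ℂ F 0) (hF : IsInitialForm F d P) (hd : 4 ≤ d)
    (hfl : ¬ HasHyperflex P) : AllSmoothSectionsReducible (zeroLocus F) := by
  rintro Y ⟨G, hGa, hG0, hdG, hY⟩
  obtain ⟨hP, -, hFP⟩ := hF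
  set L : (Fin 3 → ℂ) →L[ℂ] ℂ := fderiv ℂ G 0 with hL
  obtain ⟨b₀, b₁, e₃, hb, hLb₀, hLb₁, hLe₃⟩ := exists_basis_of_kernel hdG
  -- The tangent line is not contained in the curve, so `e₂` can be chosen off the cone; all tangent
  -- directions of the section then have finite slope.
  obtain ⟨e₁, e₂, he, hLe₁, hLe₂, hPe₂⟩ : ∃ e₁ e₂ : Fin 3 → ℂ, LinearIndependent ℂ ![e₁, e₂] ∧
      L e₁ = 0 ∧ L e₂ = 0 ∧ MvPolynomial.eval e₂ P ≠ 0 := by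
    obtain ⟨t, ht⟩ : ∃ t, (restrictToLine P b₀ b₁).eval t ≠ 0 := by
      by_contra! h
      exact restrictToLine_ne_zero hfl hb (Polynomial.funext fun t => by simp [h t])
    refine ⟨b₁, b₀ + t • b₁, ?_, hLb₁, by simp [hLb₀, hLb₁], by rwa [← eval_restrictToLine]⟩
    exact LinearIndependent.pair_symm_iff.mp (linearIndependent_add_smul hb t)
  have hli : LinearIndependent ℂ ![e₁, e₂, e₃] := by
    rw [Fintype.linearIndependent_iff]
    intro g hg
    simp only [Fin.sum_univ_three, Matrix.cons_val_zero, Matrix.cons_val_one,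
      Matrix.cons_val] at hg
    have h2 : g 2 = 0 := by simpa [hLe₁, hLe₂, hLe₃] using congrArg L hg
    rw [h2, zero_smul, add_zero] at hg
    obtain ⟨h0, h1⟩ := LinearIndependent.pair_iff.mp he _ _ hg
    intro i
    fin_cases i
    exacts [h0, h1, h2]
  let b := basisOfLinearIndependentOfCardEqFinrank hli (by simp)
  have hb0 : b 0 = e₁ := by simp [b]
  have hb1 : b 1 = e₂ := by simp [b]
  have hb2 : b 2 = e₃ := by simp [b]
  let π₁ : (Fin 3 → ℂ) →L[ℂ] ℂ := LinearMap.toContinuousLinearMap (b.coord 0)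
  let π₂ : (Fin 3 → ℂ) →L[ℂ] ℂ := LinearMap.toContinuousLinearMap (b.coord 1)
  have hπ : ∀ (i j : Fin 3), b.coord i (b j) = if i = j then 1 else 0 := fun i j => by
    rw [Module.Basis.coord_apply, Module.Basis.repr_self, Finsupp.single_apply]
    simp [eq_comm]
  have hπ₁ : π₁ e₁ = 1 ∧ π₁ e₂ = 0 ∧ π₁ e₃ = 0 := by
    refine ⟨?_, ?_, ?_⟩
    · rw [← hb0]; exact (hπ 0 0).trans (by simp)
    · rw [← hb1]; exact (hπ 0 1).trans (by simp)
    · rw [← hb2]; exact (hπ 0 2).trans (by simp)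
  have hπ₂ : π₂ e₁ = 0 ∧ π₂ e₂ = 1 ∧ π₂ e₃ = 0 := by
    refine ⟨?_, ?_, ?_⟩
    · rw [← hb0]; exact (hπ 1 0).trans (by simp)
    · rw [← hb1]; exact (hπ 1 1).trans (by simp)
    · rw [← hb2]; exact (hπ 1 2).trans (by simp)
  have hdec : ∀ x, x = π₁ x • e₁ + π₂ x • e₂ + L x • e₃ := by
    intro x
    have h1 : x = π₁ x • e₁ + π₂ x • e₂ + b.coord 2 x • e₃ := by
      conv_lhs => rw [← b.sum_repr x, Fin.sum_univ_three, hb0, hb1, hb2]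
      rfl
    have h2 : L x = b.coord 2 x := by
      conv_lhs => rw [h1]
      simp [hLe₁, hLe₂, hLe₃]
    rw [h2]
    exact h1
  let π : (Fin 3 → ℂ) →L[ℂ] ℂ × ℂ := π₁.prod π₂
  let ι : ℂ × ℂ →L[ℂ] (Fin 3 → ℂ) :=
    (ContinuousLinearMap.fst ℂ ℂ ℂ).smulRight e₁ + (ContinuousLinearMap.snd ℂ ℂ ℂ).smulRight e₂
  have hι : ∀ u, ι u = u.1 • e₁ + u.2 • e₂ := fun u => rfl
  have hπι : ∀ u, π (ι u) = u := by
    intro u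
    ext <;> simp [π, hι, hπ₁, hπ₂]
  have hLι : ∀ u, L (ι u) = 0 := by intro u; simp [hι, hLe₁, hLe₂]
  have hιπ : ∀ x, L x = 0 → ι (π x) = x := by
    intro x hx
    conv_rhs => rw [hdec x, hx, zero_smul, add_zero]
    rfl
  -- Only the `e₃` coordinate changes: `Ψ` straightens `Y` to the plane `L = 0`, commutes with the
  -- projection `π`, and has identity differential. Its inverse on that plane is the chart `ψ`.
  let Ψ : (Fin 3 → ℂ) → (Fin 3 → ℂ) := fun x => x + (G x - L x) • e₃
  have hLΨ : ∀ x, L (Ψ x) = G x := by intro x; simp [Ψ, hLe₃]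
  have hπΨ : ∀ x, π (Ψ x) = π x := by
    intro x
    have : π e₃ = 0 := by ext <;> simp [π, hπ₁, hπ₂]
    simp [Ψ, this]
  have hΨ0 : Ψ 0 = 0 := by simp [Ψ, hG0]
  have hΨa : AnalyticAt ℂ Ψ 0 :=
    analyticAt_id.add ((hGa.sub (L.analyticAt 0)).smul analyticAt_const)
  have hΨd : HasFDerivAt Ψ
      ((ContinuousLinearEquiv.refl ℂ (Fin 3 → ℂ) : (Fin 3 → ℂ) ≃L[ℂ] (Fin 3 → ℂ)) :
        (Fin 3 → ℂ) →L[ℂ] (Fin 3 → ℂ)) 0 := by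
    have h1 := (hasFDerivAt_id (𝕜 := ℂ) (0 : Fin 3 → ℂ)).add
      ((hGa.differentiableAt.hasFDerivAt.sub L.hasFDerivAt).smul_const e₃)
    refine h1.congr_fderiv ?_
    ext x i
    simp [hL]
  have hΨs : HasStrictFDerivAt Ψ
      ((ContinuousLinearEquiv.refl ℂ (Fin 3 → ℂ) : (Fin 3 → ℂ) ≃L[ℂ] (Fin 3 → ℂ)) :
        (Fin 3 → ℂ) →L[ℂ] (Fin 3 → ℂ)) 0 :=
    (hΨa.contDiffAt (n := 1)).hasStrictFDerivAt' hΨd one_ne_zero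
  -- The exponent `⊤` is the analytic class, not merely infinite differentiability, so the local
  -- inverse is again analytic.
  have hΨc : ContDiffAt ℂ ⊤ Ψ 0 := hΨa.contDiffAt
  let σ : (Fin 3 → ℂ) → (Fin 3 → ℂ) := hΨs.localInverse Ψ _ 0
  have hσ0 : σ 0 = 0 := by
    have := hΨs.localInverse_apply_image
    rwa [hΨ0] at this
  have hσa : AnalyticAt ℂ σ 0 := by
    have h1 := hΨc.to_localInverse hΨd (by simp)
    rw [hΨ0] at h1
    rw [← contDiffWithinAt_univ] at h1
    rw [← analyticWithinAt_univ]
    exact contDiffWithinAt_omega_iff_analyticWithinAt.mp h1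
  have hσΨ : ∀ᶠ x in 𝓝 0, σ (Ψ x) = x := hΨs.eventually_left_inverse
  have hΨσ : ∀ᶠ u in 𝓝 0, Ψ (σ u) = u := by
    have := hΨs.eventually_right_inverse
    rwa [hΨ0] at this
  have hσd : HasFDerivAt σ (ContinuousLinearMap.id ℂ (Fin 3 → ℂ)) 0 := by
    have h1 := hΨs.to_localInverse.hasFDerivAt
    rw [hΨ0] at h1
    exact h1.congr_fderiv (by ext; rfl)
  let ψ : ℂ × ℂ → (Fin 3 → ℂ) := fun u => σ (ι u)
  have hψ0 : ψ 0 = 0 := by simp [ψ, hσ0]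
  have hψa : AnalyticAt ℂ ψ 0 :=
    AnalyticAt.fun_comp (g := σ) (f := ι) (by rw [map_zero]; exact hσa) (ι.analyticAt 0)
  have hψd : HasFDerivAt ψ ι 0 := by
    have h1 : HasFDerivAt σ (ContinuousLinearMap.id ℂ (Fin 3 → ℂ)) (ι 0) := by
      rw [map_zero]; exact hσd
    have h2 := h1.comp 0 ι.hasFDerivAt
    exact h2.congr_fderiv (by ext <;> rfl)
  have hψt : Tendsto ψ (𝓝 0) (𝓝 0) := by
    have := hψa.continuousAt.tendsto
    rwa [hψ0] at this
  have hψo : (fun u => ψ u - ι u) =o[𝓝 0] fun u => u := by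
    have := hψd.isLittleO
    simpa [hψ0] using this
  have hιt : Tendsto ι (𝓝 0) (𝓝 0) := by
    have := ι.continuous.tendsto 0
    rwa [map_zero] at this
  have hπt : Tendsto π (𝓝 0) (𝓝 0) := by
    have := π.continuous.tendsto 0
    rwa [map_zero] at this
  have hGψ : ∀ᶠ u in 𝓝 0, G (ψ u) = 0 ∧ π (ψ u) = u := by
    filter_upwards [hιt.eventually hΨσ] with u hu
    constructor
    · rw [← hLΨ, hu, hLι]
    · rw [← hπΨ, hu, hπι]
  have hYψ : ∀ᶠ x in 𝓝 0, G x = 0 → ψ (π x) = x := by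
    filter_upwards [hσΨ] with x hx hGx
    have h1 : L (Ψ x) = 0 := by rw [hLΨ, hGx]
    change σ (ι (π x)) = x
    rw [← hπΨ, hιπ _ h1, hx]
  let p : ℂ × ℂ → ℂ := fun u => MvPolynomial.eval (ι u) P
  have hPh := eval_smul_of_isHomogeneous hP
  have hPa : ∀ x, AnalyticAt ℂ (fun x => MvPolynomial.eval x P) x := fun x =>
    AnalyticOnNhd.eval_mvPolynomial P x (Set.mem_univ x)
  have hPc : Continuous fun x => MvPolynomial.eval x P := MvPolynomial.continuous_eval P
  have hpa : ∀ x, AnalyticAt ℂ p x := fun x =>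
    AnalyticAt.fun_comp (g := fun x => MvPolynomial.eval x P) (f := ι) (hPa _) (ι.analyticAt x)
  have hfo : (fun u => F (ψ u) - p u) =o[𝓝 0] fun u : ℂ × ℂ => ‖u‖ ^ d := by
    have h1 : (fun u => F (ψ u) - MvPolynomial.eval (ψ u) P) =o[𝓝 0]
        fun u : ℂ × ℂ => ‖u‖ ^ d := by
      have h2 := hFP.comp_tendsto hψt
      refine h2.trans_isBigO ?_
      have h3 : ψ =O[𝓝 0] fun u : ℂ × ℂ => u := by
        simpa [hψ0] using hψd.isBigO_sub
      exact h3.norm_norm.pow d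
    have h2 := isLittleO_comp_homogeneous hPh hPc (α := ψ) (β := ι) (fun u => ι.le_opNorm u) hψo
      (by simp [hψ0])
    refine (h1.add h2).congr_left fun u => ?_
    simp [p]
  obtain ⟨a₁, a₂, ha₁, ha₂, hne⟩ := exists_two_roots_restrictToLine hP hd hfl he hPe₂
  obtain ⟨Λ₁, Λ₂, hΛ₁, hΛ₂, hcov, hn₁, hn₂⟩ := exists_analyticAt_decomposition
    (f := fun u => F (ψ u)) (p := p) (d := d) (by omega)
    (fun c x => by simp only [p]; rw [map_smul, hPh])
    (AnalyticAt.fun_comp (g := F) (f := ψ) (by rw [hψ0]; exact hFa) hψa) hfo hpa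
    (restrictToLine_ne_zero hfl he)
    (fun t => by rw [eval_restrictToLine]; simp [p, hι]) (by simpa [p, hι] using hPe₂) ha₁ ha₂ hne
  -- Curves in the chart become germs in `ℂ³` by pulling their equation back along `π` and adding
  -- the equation of `Y`.
  have hgerm : ∀ Λ : ℂ × ℂ → ℂ, AnalyticAt ℂ Λ 0 →
      IsAnalyticGerm {x | G x = 0 ∧ Λ (π x) = 0} := by
    intro Λ hΛ
    refine ⟨2, ![G, fun x => Λ (π x)], ?_, ?_⟩
    · intro i
      fin_cases i
      · exact hGa
      · exact AnalyticAt.fun_comp (g := Λ) (f := π) (by rw [map_zero]; exact hΛ) (π.analyticAt 0)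
    · exact Eventually.of_forall fun x => by
        simp [Fin.forall_fin_two]
  have hXY : (zeroLocus F ∩ Y : Set (Fin 3 → ℂ)) =ᶠ[𝓝 0] {x | F x = 0 ∧ G x = 0} := by
    filter_upwards [hY] with x hx
    exact propext (and_congr_right fun _ => iff_of_eq hx)
  have hneq : ∀ Λ : ℂ × ℂ → ℂ, (¬ ∀ᶠ u in 𝓝 (0 : ℂ × ℂ), F (ψ u) = 0 → Λ u = 0) →
      ¬ {x | G x = 0 ∧ Λ (π x) = 0} =ᶠ[𝓝 0] (zeroLocus F ∩ Y : Set (Fin 3 → ℂ)) := by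
    intro Λ hΛ heq
    apply hΛ
    filter_upwards [hψt.eventually (heq.trans hXY), hGψ] with u h1 h2 h3
    have h4 : G (ψ u) = 0 ∧ Λ (π (ψ u)) = 0 := (iff_of_eq h1).mpr ⟨h3, h2.1⟩
    rw [h2.2] at h4
    exact h4.2
  refine ⟨⟨2, ![F, G], fun i => by fin_cases i; exacts [hFa, hGa], hXY.trans ?_⟩,
    {x | G x = 0 ∧ Λ₁ (π x) = 0}, {x | G x = 0 ∧ Λ₂ (π x) = 0}, hgerm Λ₁ hΛ₁, hgerm Λ₂ hΛ₂,
    hXY.trans ?_, hneq Λ₁ hn₁, hneq Λ₂ hn₂⟩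
  · exact Eventually.of_forall fun x => by simp [Fin.forall_fin_two]
  · filter_upwards [hYψ, hπt.eventually hcov] with x h1 h2
    refine propext ?_
    change (F x = 0 ∧ G x = 0) ↔ (G x = 0 ∧ Λ₁ (π x) = 0) ∨ (G x = 0 ∧ Λ₂ (π x) = 0)
    rw [← and_or_left, and_comm]
    refine and_congr_right fun hG => ?_
    rw [← h2, h1 hG]

/-! ### Division by the germ, and irreducibility. -/

theorem isLittleO_norm_pow_of_isBigO_succ {E : Type*} [NormedAddCommGroup E] {g : E → ℂ} {n : ℕ}
    (h : g =O[𝓝 0] fun x => ‖x‖ ^ (n + 1)) : g =o[𝓝 0] fun x => ‖x‖ ^ n :=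
  h.trans_isLittleO (Asymptotics.isLittleO_norm_pow_norm_pow n.lt_succ_self)

theorem isBigO_norm_pow_of_le {E : Type*} [NormedAddCommGroup E] {m n : ℕ} (h : m ≤ n) :
    (fun x : E => ‖x‖ ^ n) =O[𝓝 0] fun x => ‖x‖ ^ m := by
  rcases h.eq_or_lt with rfl | h
  · exact Asymptotics.isBigO_refl _ _
  · exact (Asymptotics.isLittleO_norm_pow_norm_pow h).isBigO

/-- Along a ray `τ • x` both sides scale by the same power of `‖τ‖`, so the bound persists at `x`
with arbitrarily small constant. -/
theorem MvPolynomial.IsHomogeneous.eq_zero_of_isLittleO {A : MvPolynomial (Fin 3) ℂ} {n : ℕ}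
    (hA : A.IsHomogeneous n)
    (h : (fun x => MvPolynomial.eval x A) =o[𝓝 0] fun x : Fin 3 → ℂ => ‖x‖ ^ n) : A = 0 := by
  refine MvPolynomial.funext fun x => ?_
  rw [map_zero]
  have ht : Tendsto (fun τ : ℂ => τ • x) (𝓝[≠] 0) (𝓝 0) := by
    have : Tendsto (fun τ : ℂ => τ • x) (𝓝 0) (𝓝 ((0 : ℂ) • x)) := Continuous.tendsto (by fun_prop) 0
    rw [zero_smul] at this
    exact this.mono_left nhdsWithin_le_nhds
  have hle : ∀ ε : ℝ, 0 < ε → ‖MvPolynomial.eval x A‖ ≤ ε * ‖x‖ ^ n := by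
    intro ε hε
    obtain ⟨τ, h1, h2⟩ := (((h.comp_tendsto ht).def hε).and self_mem_nhdsWithin).exists
    have hpos : 0 < ‖τ‖ ^ n := pow_pos (norm_pos_iff.mpr h2) n
    simp only [Function.comp_apply] at h1
    rw [eval_smul_of_isHomogeneous hA, norm_mul, norm_pow, norm_pow, norm_norm, norm_smul,
      mul_pow] at h1
    refine le_of_mul_le_mul_left (h1.trans_eq ?_) hpos
    ring
  by_contra hne
  have hpos := norm_pos_iff.mpr hne
  have h1 := hle (‖MvPolynomial.eval x A‖ / (2 * (‖x‖ ^ n + 1))) (by positivity)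
  rw [div_mul_eq_mul_div, le_div_iff₀ (by positivity)] at h1
  have : 0 ≤ ‖x‖ ^ n := by positivity
  nlinarith

theorem exists_homogeneous_eval_eq (n : ℕ)
    (p : ContinuousMultilinearMap ℂ (fun _ : Fin n => (Fin 3 → ℂ)) ℂ) :
    ∃ A : MvPolynomial (Fin 3) ℂ, A.IsHomogeneous n ∧
      ∀ x, MvPolynomial.eval x A = p fun _ => x := by
  refine ⟨∑ r : Fin n → Fin 3, MvPolynomial.C (p fun i => Pi.single (r i) 1) *
    ∏ i, MvPolynomial.X (r i), MvPolynomial.IsHomogeneous.sum _ _ _ fun r _ => ?_, fun x => ?_⟩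
  · have h := MvPolynomial.IsHomogeneous.prod Finset.univ
      (fun i : Fin n => (MvPolynomial.X (r i) : MvPolynomial (Fin 3) ℂ)) (fun _ => 1)
      (fun i _ => MvPolynomial.isHomogeneous_X ℂ (r i))
    simpa using h.C_mul (p fun i => Pi.single (r i) 1)
  · have hx : (fun _ : Fin n => x) = fun _ : Fin n => ∑ j, x j • (Pi.single j 1 : Fin 3 → ℂ) := by
      funext _
      exact pi_eq_sum_univ' x
    rw [hx, ContinuousMultilinearMap.map_sum]
    simp only [map_sum, map_mul, MvPolynomial.eval_C, map_prod, MvPolynomial.eval_X]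
    refine Finset.sum_congr rfl fun r _ => ?_
    rw [ContinuousMultilinearMap.map_smul_univ, smul_eq_mul, mul_comm]

/-- The lowest-order Taylor term of an analytic germ is a form. -/
theorem exists_homogeneous_isBigO {g : (Fin 3 → ℂ) → ℂ} (hg : AnalyticAt ℂ g 0) {m : ℕ}
    (hO : g =O[𝓝 0] fun x => ‖x‖ ^ m) :
    ∃ A : MvPolynomial (Fin 3) ℂ, A.IsHomogeneous m ∧
      (fun x => g x - MvPolynomial.eval x A) =O[𝓝 0] fun x => ‖x‖ ^ (m + 1) := by
  obtain ⟨p, hp⟩ := hg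
  choose A hA hAe using fun n => exists_homogeneous_eval_eq n (p n)
  have hT : ∀ n, (fun x => g x - ∑ k ∈ Finset.range n, MvPolynomial.eval x (A k)) =O[𝓝 0]
      fun x => ‖x‖ ^ n := by
    intro n
    have h := hp.isBigO_sub_partialSum_pow n
    simpa only [zero_add, FormalMultilinearSeries.partialSum, ← hAe] using h
  have hz : ∀ k < m, A k = 0 := by
    intro k
    induction k using Nat.strong_induction_on with
    | _ k ih =>
      intro hk
      refine (hA k).eq_zero_of_isLittleO (isLittleO_norm_pow_of_isBigO_succ ?_)
      have h1 := hT (k + 1)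
      have h2 := hO.trans (isBigO_norm_pow_of_le (Nat.succ_le_of_lt hk))
      refine (h2.sub h1).congr_left fun x => ?_
      rw [Finset.sum_range_succ, Finset.sum_eq_zero]
      · ring
      · intro j hj
        rw [ih j (Finset.mem_range.mp hj) ((Finset.mem_range.mp hj).trans hk), map_zero]
  refine ⟨A m, hA m, (hT (m + 1)).congr_left fun x => ?_⟩
  rw [Finset.sum_range_succ, Finset.sum_eq_zero, zero_add]
  intro j hj
  rw [hz j (Finset.mem_range.mp hj), map_zero]

/-- The cofactor may be replaced by its component of the complementary degree, as `A` and `P` are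
homogeneous. -/
theorem exists_homogeneous_factor {P A h : MvPolynomial (Fin 3) ℂ} {d n : ℕ}
    (hP : P.IsHomogeneous d) (hA : A.IsHomogeneous n) (hPA : A = P * h) (hA0 : A ≠ 0) :
    ∃ k h', n = d + k ∧ h'.IsHomogeneous k ∧ A = P * h' := by
  let _ : GradedAlgebra (MvPolynomial.homogeneousSubmodule (Fin 3) ℂ) := MvPolynomial.gradedAlgebra
  have hdec : ∀ (φ : MvPolynomial (Fin 3) ℂ) (k : ℕ),
      (DirectSum.decompose (MvPolynomial.homogeneousSubmodule (Fin 3) ℂ) φ k :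
        MvPolynomial (Fin 3) ℂ) = MvPolynomial.homogeneousComponent k φ :=
    fun φ k => MvPolynomial.decomposition.decompose'_apply φ k
  have hAn : A = MvPolynomial.homogeneousComponent n (P * h) := by
    rw [← hPA, MvPolynomial.homogeneousComponent_eq_self hA]
  rw [← hdec] at hAn
  by_cases hdn : d ≤ n
  · refine ⟨n - d, MvPolynomial.homogeneousComponent (n - d) h, by omega,
      MvPolynomial.homogeneousComponent_isHomogeneous _ _, ?_⟩
    rw [hAn, DirectSum.coe_decompose_mul_of_left_mem_of_le _ hP hdn, hdec]
  · rw [DirectSum.coe_decompose_mul_of_left_mem_of_not_le _ hP hdn] at hAn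
    exact absurd hAn hA0

theorem isBigO_eval_of_isHomogeneous {A : MvPolynomial (Fin 3) ℂ} {n : ℕ}
    (hA : A.IsHomogeneous n) :
    (fun x => MvPolynomial.eval x A) =O[𝓝 0] fun x : Fin 3 → ℂ => ‖x‖ ^ n := by
  obtain ⟨B, hB⟩ := (isCompact_closedBall (0 : Fin 3 → ℂ) 1).exists_bound_of_continuousOn
    (MvPolynomial.continuous_eval A).continuousOn
  refine Asymptotics.IsBigO.of_bound B (Eventually.of_forall fun x => ?_)
  rw [norm_pow, norm_norm]
  by_cases hx : x = 0
  · subst hx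
    have h1 := eval_smul_of_isHomogeneous hA 0 0
    rw [zero_smul] at h1
    rw [h1, norm_zero, norm_mul, norm_pow, norm_zero, mul_comm]
    exact mul_le_mul_of_nonneg_right (hB 0 (Metric.mem_closedBall_self zero_le_one)) (by positivity)
  have hxn : (‖x‖ : ℂ) ≠ 0 := by simpa using hx
  have h1 : x = (‖x‖ : ℂ) • ((‖x‖ : ℂ)⁻¹ • x) := by
    rw [smul_smul, mul_inv_cancel₀ hxn, one_smul]
  have h2 := hB ((‖x‖ : ℂ)⁻¹ • x) (by
    rw [mem_closedBall_zero_iff, norm_smul, norm_inv, Complex.norm_real, norm_norm]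
    exact (inv_mul_cancel₀ (norm_ne_zero_iff.mpr hx)).le)
  conv_lhs => rw [h1]
  rw [eval_smul_of_isHomogeneous hA, norm_mul, norm_pow, Complex.norm_real, norm_norm, mul_comm]
  exact mul_le_mul_of_nonneg_right h2 (by positivity)

/-- Division by a germ with initial form `P`: the process either never stops, or stops at a
remainder with an initial form not divisible by `P`. -/
theorem exists_remainder_or_flat {F a : (Fin 3 → ℂ) → ℂ} {P : MvPolynomial (Fin 3) ℂ} {d : ℕ}
    (hFa : AnalyticAt ℂ F 0) (hF : IsInitialForm F d P) (haa : AnalyticAt ℂ a 0) :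
    (∃ (q A : MvPolynomial (Fin 3) ℂ) (n : ℕ), A.IsHomogeneous n ∧ ¬ P ∣ A ∧
      (fun x => a x - F x * MvPolynomial.eval x q - MvPolynomial.eval x A) =o[𝓝 0]
        fun x => ‖x‖ ^ n) ∨
    ∀ n : ℕ, ∃ q : MvPolynomial (Fin 3) ℂ,
      (fun x => a x - F x * MvPolynomial.eval x q) =O[𝓝 0] fun x => ‖x‖ ^ n := by
  obtain ⟨hP, hP0, hFP⟩ := hF
  have hea : ∀ q : MvPolynomial (Fin 3) ℂ, AnalyticAt ℂ (fun x => MvPolynomial.eval x q) 0 :=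
    fun q => AnalyticOnNhd.eval_mvPolynomial q 0 (Set.mem_univ 0)
  rw [or_iff_not_imp_left]
  intro hno n
  -- Analyticity upgrades the little-o in the definition of the initial form to a gain of one full
  -- order.
  have hFP' : (fun x => F x - MvPolynomial.eval x P) =O[𝓝 0] fun x => ‖x‖ ^ (d + 1) := by
    obtain ⟨A, hA, hAO⟩ := exists_homogeneous_isBigO (hFa.sub (hea P)) hFP.isBigO
    have hA0 : A = 0 := hA.eq_zero_of_isLittleO
      ((hFP.sub (isLittleO_norm_pow_of_isBigO_succ hAO)).congr_left fun x => by simp)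
    simpa [hA0] using hAO
  induction n with
  | zero =>
    refine ⟨0, ?_⟩
    simpa using haa.continuousAt.isBigO_one ℝ
  | succ n ih =>
    obtain ⟨q, hq⟩ := ih
    obtain ⟨A, hA, hAO⟩ := exists_homogeneous_isBigO (haa.sub (hFa.mul (hea q))) hq
    have hdvd : P ∣ A := by
      by_contra hnd
      exact hno ⟨q, A, n, hA, hnd, isLittleO_norm_pow_of_isBigO_succ hAO⟩
    by_cases hA0 : A = 0
    · exact ⟨q, by simpa [hA0] using hAO⟩
    obtain ⟨h, hh⟩ := hdvd
    obtain ⟨k, h', rfl, hh', hAh⟩ := exists_homogeneous_factor hP hA hh hA0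
    -- Subtracting `F * h'` cancels `A = P * h'` up to `(F - P) * h'`, which is one order higher.
    refine ⟨q + h', ?_⟩
    have h1 := hFP'.mul (isBigO_eval_of_isHomogeneous hh')
    have h2 : (fun x => (F x - MvPolynomial.eval x P) * MvPolynomial.eval x h') =O[𝓝 0]
        fun x => ‖x‖ ^ (d + k + 1) := by
      refine h1.congr_right fun x => ?_
      rw [← pow_add]; congr 1; omega
    refine (hAO.sub h2).congr_left fun x => ?_
    simp only [Pi.sub_apply, Pi.mul_apply, hAh, map_mul, map_add]
    ring

theorem MvPolynomial.exists_eval_ne_zero {P : MvPolynomial (Fin 3) ℂ} (hP : P ≠ 0) :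
    ∃ e, MvPolynomial.eval e P ≠ 0 := by
  by_contra! h
  exact hP (MvPolynomial.funext fun x => by rw [h x, map_zero])

/-- Otherwise `P` vanishes on the whole line through `v` in direction `e`, hence by homogeneity also
at its point at infinity `e`. -/
theorem not_eventually_eval_add_smul_eq_zero {P : MvPolynomial (Fin 3) ℂ} {d : ℕ}
    (hP : P.IsHomogeneous d) {v e : Fin 3 → ℂ} (he : MvPolynomial.eval e P ≠ 0) :
    ¬ ∀ᶠ w in 𝓝 (0 : ℂ), MvPolynomial.eval (v + w • e) P = 0 := by
  intro hev
  have h0 : restrictToLine P v e = 0 := by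
    refine Polynomial.eq_zero_of_infinite_isRoot _ ?_
    have h1 : {w | MvPolynomial.eval (v + w • e) P = 0} ∈ 𝓝 (0 : ℂ) := hev
    refine (infinite_of_mem_nhds 0 h1).mono fun w hw => ?_
    change (restrictToLine P v e).eval w = 0
    rw [eval_restrictToLine]
    exact hw
  have h2 : restrictToLine P e v = 0 := by
    refine Polynomial.eq_zero_of_infinite_isRoot _
      ((Set.finite_singleton (0 : ℂ)).infinite_compl.mono fun T hT => ?_)
    have hT : T ≠ 0 := hT
    change (restrictToLine P e v).eval T = 0
    have h3 : e + T • v = T • (v + T⁻¹ • e) := by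
      rw [smul_add, smul_smul, mul_inv_cancel₀ hT, one_smul, add_comm]
    rw [eval_restrictToLine, h3, eval_smul_of_isHomogeneous hP, ← eval_restrictToLine, h0]
    simp
  apply he
  have h4 := eval_restrictToLine P e v 0
  rw [h2] at h4
  simpa using h4.symm

/-- If a product of two analytic germs vanishes on a hypersurface germ with irreducible tangent
cone, one of the factors does. -/
theorem eventually_eq_zero_or_of_mul {F a b : (Fin 3 → ℂ) → ℂ} {P : MvPolynomial (Fin 3) ℂ} {d : ℕ}
    (hFa : AnalyticAt ℂ F 0) (hF : IsInitialForm F d P) (hd : d ≠ 0) (hirr : Irreducible P)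
    (haa : AnalyticAt ℂ a 0) (hba : AnalyticAt ℂ b 0)
    (hab : ∀ᶠ x in 𝓝 0, F x = 0 → a x * b x = 0) :
    (∀ᶠ x in 𝓝 0, F x = 0 → a x = 0) ∨ ∀ᶠ x in 𝓝 0, F x = 0 → b x = 0 := by
  obtain ⟨e, he⟩ := MvPolynomial.exists_eval_ne_zero hF.2.1
  have hPh := eval_smul_of_isHomogeneous hF.1
  have hflat : ∀ c : (Fin 3 → ℂ) → ℂ, AnalyticAt ℂ c 0 →
      (∀ n : ℕ, ∃ q : MvPolynomial (Fin 3) ℂ,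
        (fun x => c x - F x * MvPolynomial.eval x q) =O[𝓝 0] fun x => ‖x‖ ^ n) →
      ∀ᶠ x in 𝓝 0, F x = 0 → c x = 0 := by
    intro c hc h
    refine eventually_eq_zero_of_flat hd hPh hFa hc hF.2.2 (MvPolynomial.continuous_eval P) he
      fun n => ?_
    obtain ⟨q, hq⟩ := h n
    obtain ⟨C, hC⟩ := hq.bound
    refine ⟨C, hC.mono fun x hx hFx => ?_⟩
    simpa [hFx] using hx
  rcases exists_remainder_or_flat hFa hF haa with ⟨q, A, n, hA, hPA, hAo⟩ | h
  swap
  · exact Or.inl (hflat a haa h)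
  rcases exists_remainder_or_flat hFa hF hba with ⟨q', B, n', hB, hPB, hBo⟩ | h
  swap
  · exact Or.inr (hflat b hba h)
  exfalso
  -- If `A` and `B` were nonzero at `v`, then at rescaled points of `X` near `v` both remainders
  -- would be nonzero. On `F = 0` these remainders are `a` and `b` themselves, whose product
  -- vanishes.
  have hvan : ∀ v, MvPolynomial.eval v P = 0 → MvPolynomial.eval v (A * B) = 0 := by
    intro v hv
    by_contra hne
    have hc : Continuous fun w : ℂ => MvPolynomial.eval (v + w • e) (A * B) :=
      (MvPolynomial.continuous_eval _).comp (by fun_prop)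
    obtain ⟨r, hr, hrAB⟩ := Metric.nhds_basis_closedBall.eventually_iff.mp
      (hc.continuousAt.eventually_ne (x := 0) (by rwa [zero_smul, add_zero]))
    set K : Set (Fin 3 → ℂ) := (fun w : ℂ => v + w • e) '' Metric.closedBall 0 r
    have hK : IsCompact K := (isCompact_closedBall _ _).image (by fun_prop)
    have hKA : ∀ x ∈ K, MvPolynomial.eval x A ≠ 0 := by
      rintro _ ⟨w, hw, rfl⟩
      have := hrAB hw
      rw [map_mul] at this
      exact left_ne_zero_of_mul this
    have hKB : ∀ x ∈ K, MvPolynomial.eval x B ≠ 0 := by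
      rintro _ ⟨w, hw, rfl⟩
      have := hrAB hw
      rw [map_mul] at this
      exact right_ne_zero_of_mul this
    have h1 := eventually_ne_zero_of_isCompact (eval_smul_of_isHomogeneous hA) hAo hK
      (MvPolynomial.continuous_eval A) hKA
    have h2 := eventually_ne_zero_of_isCompact (eval_smul_of_isHomogeneous hB) hBo hK
      (MvPolynomial.continuous_eval B) hKB
    have h3 := eventually_exists_zero_near hPh hFa hF.2.2 (MvPolynomial.continuous_eval P) hv
      (e := e) (AnalyticAt.fun_comp (g := fun x => MvPolynomial.eval x P)
        (f := fun w : ℂ => v + w • e) (AnalyticOnNhd.eval_mvPolynomial P _ (Set.mem_univ _))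
        (analyticAt_const.add (analyticAt_id.smul analyticAt_const)))
      (not_eventually_eval_add_smul_eq_zero hF.1 he) hr
    have h4 := eventually_forall_smul_of_isBounded hab hK.isBounded
    obtain ⟨τ, ⟨⟨⟨h5, h6⟩, h7⟩, h8⟩, h9⟩ := (Filter.Eventually.and
      (mem_nhdsWithin_of_mem_nhds (((h1.and h2).and h3).and h4))
      (self_mem_nhdsWithin (a := (0 : ℂ)) (s := {0}ᶜ))).exists
    have h9 : τ ≠ 0 := h9
    obtain ⟨w, hw, hFw⟩ := h7 h9
    have hmem : v + w • e ∈ K := ⟨w, mem_closedBall_zero_iff.mpr hw.le, rfl⟩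
    have h10 := h5 h9 _ hmem
    have h11 := h6 h9 _ hmem
    rw [hFw, zero_mul, sub_zero] at h10 h11
    exact mul_ne_zero h10 h11 (h8 _ hmem hFw)
  have hprime : Prime P := hirr.prime
  have hI : (Ideal.span {P}).IsPrime := (Ideal.span_singleton_prime hprime.ne_zero).mpr hprime
  have hmem : A * B ∈ MvPolynomial.vanishingIdeal ℂ (MvPolynomial.zeroLocus ℂ (Ideal.span {P})) := by
    rw [MvPolynomial.mem_vanishingIdeal_iff]
    intro v hv
    have h1 := (MvPolynomial.mem_zeroLocus_iff.mp hv) P (Ideal.mem_span_singleton_self P)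
    exact hvan v h1
  rw [MvPolynomial.IsPrime.vanishingIdeal_zeroLocus, Ideal.mem_span_singleton] at hmem
  rcases hprime.dvd_or_dvd hmem with h | h
  exacts [hPA h, hPB h]

/-- A hypersurface germ with irreducible initial form is irreducible. -/
theorem isIrreducibleGerm_zeroLocus {F : (Fin 3 → ℂ) → ℂ} {P : MvPolynomial (Fin 3) ℂ} {d : ℕ}
    (hFa : AnalyticAt ℂ F 0) (hF : IsInitialForm F d P) (hd : d ≠ 0) (hirr : Irreducible P) :
    IsIrreducibleGerm (zeroLocus F) := by
  have hF0 : F 0 = 0 := by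
    have h := hF.2.2.def one_pos |>.self_of_nhds
    have h1 := eval_smul_of_isHomogeneous hF.1 0 0
    rw [zero_smul, zero_pow hd, zero_mul] at h1
    rw [h1] at h
    simpa [hd] using h
  refine ⟨⟨1, fun _ => F, fun _ => hFa, Eventually.of_forall fun x => by simp [zeroLocus]⟩,
    hF0, ?_⟩
  rintro ⟨-, A, B, ⟨k, f, hf, hA⟩, ⟨l, g, hg, hB⟩, hAB, hAX, hBX⟩
  -- A component smaller than `X` has a defining equation that does not vanish on `X`.
  have hexists : ∀ {C : Set (Fin 3 → ℂ)} {k : ℕ} {f : Fin k → (Fin 3 → ℂ) → ℂ},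
      C =ᶠ[𝓝 0] {x | ∀ i, f i x = 0} → ¬ C =ᶠ[𝓝 0] zeroLocus F →
      (∀ᶠ x in 𝓝 0, x ∈ C → F x = 0) → ∃ i, ¬ ∀ᶠ x in 𝓝 0, F x = 0 → f i x = 0 := by
    intro C k f hC hCX hsub
    by_contra! hall
    apply hCX
    filter_upwards [hC, hsub, eventually_all.mpr hall] with x h1 h2 h3
    refine propext ⟨h2, fun h => (iff_of_eq h1).mpr fun i => h3 i h⟩
  have hsubA : ∀ᶠ x in 𝓝 0, x ∈ A → F x = 0 := by
    filter_upwards [hAB] with x hx h using (iff_of_eq hx).mpr (Or.inl h)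
  have hsubB : ∀ᶠ x in 𝓝 0, x ∈ B → F x = 0 := by
    filter_upwards [hAB] with x hx h using (iff_of_eq hx).mpr (Or.inr h)
  obtain ⟨i, hi⟩ := hexists hA hAX hsubA
  obtain ⟨j, hj⟩ := hexists hB hBX hsubB
  have hab : ∀ᶠ x in 𝓝 0, F x = 0 → f i x * g j x = 0 := by
    filter_upwards [hAB, hA, hB] with x h1 h2 h3 hFx
    rcases (iff_of_eq h1).mp hFx with h | h
    · rw [(iff_of_eq h2).mp h i, zero_mul]
    · rw [(iff_of_eq h3).mp h j, mul_zero]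
  rcases eventually_eq_zero_or_of_mul hFa hF hd hirr (hf i) (hg j) hab with h | h
  exacts [hi h, hj h]

/-! ### Pairs of conics. -/

theorem exists_ternary_quadratic {Q : MvPolynomial (Fin 3) ℂ} (hQ : Q.IsHomogeneous 2) :
    ∃ a b c e f g : ℂ, Q = MvPolynomial.C a * MvPolynomial.X 0 ^ 2 +
      MvPolynomial.C b * MvPolynomial.X 1 ^ 2 + MvPolynomial.C c * MvPolynomial.X 2 ^ 2 +
      MvPolynomial.C e * (MvPolynomial.X 0 * MvPolynomial.X 1) +
      MvPolynomial.C f * (MvPolynomial.X 0 * MvPolynomial.X 2) +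
      MvPolynomial.C g * (MvPolynomial.X 1 * MvPolynomial.X 2) := by
  have h : Q ∈ MvPolynomial.homogeneousSubmodule (Fin 3) ℂ 2 := hQ
  rw [← MvPolynomial.homogeneousSubmodule_one_pow, MvPolynomial.homogeneousSubmodule_one_eq_span_X,
    pow_two, Submodule.span_mul_span] at h
  clear hQ
  induction h using Submodule.span_induction with
  | mem x hx =>
    obtain ⟨_, ⟨i, rfl⟩, _, ⟨j, rfl⟩, rfl⟩ := hx
    fin_cases i <;> fin_cases j
    · exact ⟨1, 0, 0, 0, 0, 0, by simp [pow_two]⟩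
    · exact ⟨0, 0, 0, 1, 0, 0, by simp⟩
    · exact ⟨0, 0, 0, 0, 1, 0, by simp⟩
    · exact ⟨0, 0, 0, 1, 0, 0, by simp; exact mul_comm _ _⟩
    · exact ⟨0, 1, 0, 0, 0, 0, by simp [pow_two]⟩
    · exact ⟨0, 0, 0, 0, 0, 1, by simp⟩
    · exact ⟨0, 0, 0, 0, 1, 0, by simp; exact mul_comm _ _⟩
    · exact ⟨0, 0, 0, 0, 0, 1, by simp; exact mul_comm _ _⟩
    · exact ⟨0, 0, 1, 0, 0, 0, by simp [pow_two]⟩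
  | zero => exact ⟨0, 0, 0, 0, 0, 0, by simp⟩
  | add x y _ _ hx hy =>
    obtain ⟨a, b, c, e, f, g, rfl⟩ := hx
    obtain ⟨a', b', c', e', f', g', rfl⟩ := hy
    exact ⟨a + a', b + b', c + c', e + e', f + f', g + g', by simp only [map_add]; ring⟩
  | smul r x _ hx =>
    obtain ⟨a, b, c, e, f, g, rfl⟩ := hx
    exact ⟨r * a, r * b, r * c, r * e, r * f, r * g, by
      simp only [map_mul, MvPolynomial.smul_eq_C_mul]; ring⟩

/-- The value, gradient, and restriction to lines of a ternary quadratic form. -/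
theorem exists_gradientAt_quadratic {Q : MvPolynomial (Fin 3) ℂ} (hQ : Q.IsHomogeneous 2) :
    (∀ (s t : ℂ) (v w : Fin 3 → ℂ), gradientAt Q (s • v + t • w) =
      s • gradientAt Q v + t • gradientAt Q w) ∧
    (∀ v w, gradientAt Q v ⬝ᵥ w = gradientAt Q w ⬝ᵥ v) ∧
    (∀ v, gradientAt Q v ⬝ᵥ v = 2 * MvPolynomial.eval v Q) ∧
    ∀ p q, restrictToLine Q p q = Polynomial.C (MvPolynomial.eval p Q) +
      Polynomial.C (gradientAt Q p ⬝ᵥ q) * Polynomial.X +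
      Polynomial.C (MvPolynomial.eval q Q) * Polynomial.X ^ 2 := by
  obtain ⟨a, b, c, e, f, g, rfl⟩ := exists_ternary_quadratic hQ
  have hgrad : ∀ v : Fin 3 → ℂ, gradientAt (MvPolynomial.C a * MvPolynomial.X 0 ^ 2 +
      MvPolynomial.C b * MvPolynomial.X 1 ^ 2 + MvPolynomial.C c * MvPolynomial.X 2 ^ 2 +
      MvPolynomial.C e * (MvPolynomial.X 0 * MvPolynomial.X 1) +
      MvPolynomial.C f * (MvPolynomial.X 0 * MvPolynomial.X 2) +
      MvPolynomial.C g * (MvPolynomial.X 1 * MvPolynomial.X 2)) v =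
      ![2 * a * v 0 + e * v 1 + f * v 2, 2 * b * v 1 + e * v 0 + g * v 2,
        2 * c * v 2 + f * v 0 + g * v 1] := by
    intro v
    funext i
    fin_cases i <;> simp [gradientAt, MvPolynomial.pderiv_X] <;> ring
  refine ⟨fun s t v w => ?_, fun v w => ?_, fun v => ?_, fun p q => ?_⟩
  · simp only [hgrad]
    funext i
    fin_cases i <;> simp <;> ring
  · simp only [hgrad, dotProduct, Fin.sum_univ_three]
    simp
    ring
  · simp only [hgrad, dotProduct, Fin.sum_univ_three]
    simp
    ring
  · refine Polynomial.funext fun t => ?_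
    rw [eval_restrictToLine]
    simp only [hgrad, dotProduct, Fin.sum_univ_three]
    simp
    ring

/-- If all minors vanish, then `p i • q = q i • p` for each `i`, and independence forces `p = 0`. -/
theorem exists_minor_ne_zero {p q : Fin 3 → ℂ} (h : LinearIndependent ℂ ![p, q]) :
    p 0 * q 1 - p 1 * q 0 ≠ 0 ∨ p 2 * q 0 - p 0 * q 2 ≠ 0 ∨ p 1 * q 2 - p 2 * q 1 ≠ 0 := by
  by_contra! hno
  obtain ⟨h2, h1, h0⟩ := hno
  rw [LinearIndependent.pair_iff] at h
  have hz : ∀ i, q i = 0 ∧ -p i = 0 := by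
    intro i
    refine h _ _ ?_
    funext j
    simp only [Pi.add_apply, Pi.smul_apply, smul_eq_mul, Pi.zero_apply]
    fin_cases i <;> fin_cases j <;> simp only [Fin.zero_eta, Fin.mk_one, Fin.reduceFinMk]
    · ring
    · linear_combination -h2
    · linear_combination h1
    · linear_combination h2
    · ring
    · linear_combination -h0
    · linear_combination -h1
    · linear_combination h0
    · ring
  have hp : p = 0 := funext fun i => by simpa using (hz i).2
  have := h 1 0 (by simp [hp])
  exact one_ne_zero this.1

theorem exists_eq_smul_cross {p q g : Fin 3 → ℂ} (h : LinearIndependent ℂ ![p, q])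
    (hp : g ⬝ᵥ p = 0) (hq : g ⬝ᵥ q = 0) :
    ∃ c : ℂ, g = c • ![p 1 * q 2 - p 2 * q 1, p 2 * q 0 - p 0 * q 2, p 0 * q 1 - p 1 * q 0] := by
  simp only [dotProduct, Fin.sum_univ_three] at hp hq
  rcases exists_minor_ne_zero h with hn | hn | hn
  · refine ⟨g 2 / (p 0 * q 1 - p 1 * q 0), funext fun i => ?_⟩
    fin_cases i <;> simp <;> field_simp
    · linear_combination q 1 * hp - p 1 * hq
    · linear_combination p 0 * hq - q 0 * hp
  · refine ⟨g 1 / (p 2 * q 0 - p 0 * q 2), funext fun i => ?_⟩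
    fin_cases i <;> simp <;> field_simp
    · linear_combination p 2 * hq - q 2 * hp
    · linear_combination q 0 * hp - p 0 * hq
  · refine ⟨g 0 / (p 1 * q 2 - p 2 * q 1), funext fun i => ?_⟩
    fin_cases i <;> simp <;> field_simp
    · linear_combination q 2 * hp - p 2 * hq
    · linear_combination p 1 * hq - q 1 * hp

/-- On a line contained in the conic every gradient is a multiple of the covector of the line. The
gradient is linear in the point, so it vanishes at some point of the line, and the conic is singular
there. -/
theorem restrictToLine_ne_zero_of_isSmoothPlaneCurve {Q : MvPolynomial (Fin 3) ℂ}
    (hQ : Q.IsHomogeneous 2) (hs : IsSmoothPlaneCurve Q) {p q : Fin 3 → ℂ}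
    (h : LinearIndependent ℂ ![p, q]) : restrictToLine Q p q ≠ 0 := by
  obtain ⟨hlin, hsymm, heuler, hres⟩ := exists_gradientAt_quadratic hQ
  intro h0
  rw [hres] at h0
  have hp : MvPolynomial.eval p Q = 0 := by simpa using congrArg (Polynomial.coeff · 0) h0
  have hpq : gradientAt Q p ⬝ᵥ q = 0 := by
    simpa [Polynomial.coeff_X, Polynomial.coeff_C] using congrArg (Polynomial.coeff · 1) h0
  have hq : MvPolynomial.eval q Q = 0 := by
    simpa [Polynomial.coeff_X, Polynomial.coeff_C] using congrArg (Polynomial.coeff · 2) h0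
  obtain ⟨c, hc⟩ := exists_eq_smul_cross h (by rw [heuler, hp, mul_zero]) hpq
  obtain ⟨c', hc'⟩ := exists_eq_smul_cross h (g := gradientAt Q q) (by rw [hsymm, hpq])
    (by rw [heuler, hq, mul_zero])
  have hli := LinearIndependent.pair_iff.mp h
  by_cases hcc : c = 0
  · refine hs p (h.ne_zero 0) hp ?_
    rw [hc, hcc, zero_smul]
  · have hv : gradientAt Q (c' • p + (-c) • q) = 0 := by
      rw [hlin, hc, hc', smul_smul, smul_smul, ← add_smul]
      ring_nf
      simp
    refine hs (c' • p + (-c) • q) (fun hv0 => ?_) ?_ hv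
    · exact hcc (neg_eq_zero.mp (hli _ _ hv0).2)
    · have := heuler (c' • p + (-c) • q)
      rw [hv, zero_dotProduct] at this
      simpa using this.symm

theorem not_hasHyperflex_mul_conics {Q₁ Q₂ : MvPolynomial (Fin 3) ℂ} (h₁ : Q₁.IsHomogeneous 2)
    (h₂ : Q₂.IsHomogeneous 2) (hs₁ : IsSmoothPlaneCurve Q₁) (hs₂ : IsSmoothPlaneCurve Q₂)
    (ht : AreNonTangent Q₁ Q₂) : ¬ HasHyperflex (Q₁ * Q₂) := by
  rintro ⟨p, q, h, hdvd⟩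
  have hn₁ := restrictToLine_ne_zero_of_isSmoothPlaneCurve h₁ hs₁ h
  have hn₂ := restrictToLine_ne_zero_of_isSmoothPlaneCurve h₂ hs₂ h
  obtain ⟨-, -, he₁, hr₁⟩ := exists_gradientAt_quadratic h₁
  obtain ⟨-, -, he₂, hr₂⟩ := exists_gradientAt_quadratic h₂
  have hmul : restrictToLine (Q₁ * Q₂) p q = restrictToLine Q₁ p q * restrictToLine Q₂ p q :=
    map_mul _ _ _
  rw [hmul] at hdvd
  have hp₁ := he₁ p
  have hp₂ := he₂ p
  rw [hr₁] at hn₁ hdvd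
  rw [hr₂] at hn₂ hdvd
  -- Two nonzero polynomials of degree at most two whose product has order at least four must each
  -- have order two.
  have hgoal : MvPolynomial.eval p Q₁ = 0 ∧ gradientAt Q₁ p ⬝ᵥ q = 0 ∧
      MvPolynomial.eval p Q₂ = 0 ∧ gradientAt Q₂ p ⬝ᵥ q = 0 := by
    generalize MvPolynomial.eval p Q₁ = a₀ at *
    generalize gradientAt Q₁ p ⬝ᵥ q = a₁ at *
    generalize MvPolynomial.eval q Q₁ = a₂ at *
    generalize MvPolynomial.eval p Q₂ = b₀ at *
    generalize gradientAt Q₂ p ⬝ᵥ q = b₁ at *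
    generalize MvPolynomial.eval q Q₂ = b₂ at *
    have ha : ¬ (a₀ = 0 ∧ a₁ = 0 ∧ a₂ = 0) := by
      rintro ⟨rfl, rfl, rfl⟩; simp at hn₁
    have hb : ¬ (b₀ = 0 ∧ b₁ = 0 ∧ b₂ = 0) := by
      rintro ⟨rfl, rfl, rfl⟩; simp at hn₂
    have hexp : (Polynomial.C a₀ + Polynomial.C a₁ * Polynomial.X +
        Polynomial.C a₂ * Polynomial.X ^ 2) * (Polynomial.C b₀ + Polynomial.C b₁ * Polynomial.X +
        Polynomial.C b₂ * Polynomial.X ^ 2) = Polynomial.C (a₀ * b₀) +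
        Polynomial.C (a₀ * b₁ + a₁ * b₀) * Polynomial.X +
        Polynomial.C (a₀ * b₂ + a₁ * b₁ + a₂ * b₀) * Polynomial.X ^ 2 +
        Polynomial.C (a₁ * b₂ + a₂ * b₁) * Polynomial.X ^ 3 +
        Polynomial.C (a₂ * b₂) * Polynomial.X ^ 4 := by
      simp only [map_add, map_mul]; ring
    rw [hexp, Polynomial.X_pow_dvd_iff] at hdvd
    have e0 := hdvd 0 (by norm_num)
    have e1 := hdvd 1 (by norm_num)
    have e2 := hdvd 2 (by norm_num)
    have e3 := hdvd 3 (by norm_num)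
    simp only [Polynomial.coeff_add, Polynomial.coeff_C_mul, Polynomial.coeff_X_pow,
      Polynomial.coeff_C, Polynomial.coeff_X] at e0 e1 e2 e3
    norm_num at e0 e1 e2 e3
    clear hn₁ hn₂ hexp hdvd
    have ha0 : a₀ = 0 := by
      by_contra hne
      have hb0 : b₀ = 0 := e0.resolve_left hne
      subst hb0
      have hb1 : b₁ = 0 := by simpa [hne] using e1
      subst hb1
      have hb2 : b₂ = 0 := by simpa [hne] using e2
      exact hb ⟨rfl, rfl, hb2⟩
    have hb0 : b₀ = 0 := by
      by_contra hne
      subst ha0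
      have ha1 : a₁ = 0 := by simpa [hne] using e1
      subst ha1
      have ha2 : a₂ = 0 := by simpa [hne] using e2
      exact ha ⟨rfl, rfl, ha2⟩
    subst ha0 hb0
    have ha1 : a₁ = 0 := by
      by_contra hne
      have hb1 : b₁ = 0 := by simpa [hne] using e2
      subst hb1
      have hb2 : b₂ = 0 := by simpa [hne] using e3
      exact hb ⟨rfl, rfl, hb2⟩
    have hb1 : b₁ = 0 := by
      by_contra hne
      subst ha1
      have ha2 : a₂ = 0 := by simpa [hne] using e3
      exact ha ⟨rfl, rfl, ha2⟩
    exact ⟨rfl, ha1, rfl, hb1⟩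
  obtain ⟨hz₁, hg₁, hz₂, hg₂⟩ := hgoal
  have hp0 : p ≠ 0 := h.ne_zero 0
  have hli := LinearIndependent.pair_iff.mp (ht p hp0 hz₁ hz₂)
  obtain ⟨c, hc⟩ := exists_eq_smul_cross h (by rw [hp₁, hz₁, mul_zero]) hg₁
  obtain ⟨c', hc'⟩ := exists_eq_smul_cross h (by rw [hp₂, hz₂, mul_zero]) hg₂
  -- Both gradients at `p` are multiples of the covector of the line, against transversality.
  have h0 := hli c' (-c) (by
    rw [hc, hc', smul_smul, smul_smul, ← add_smul]
    ring_nf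
    simp)
  have hc0 : c = 0 := neg_eq_zero.mp h0.2
  have h1 := hli 1 0 (by rw [hc, hc0]; simp)
  exact one_ne_zero h1.1

/-! ### The explicit quartic: smoothness and absence of hyperflexes. -/

theorem isHomogeneous_exampleQuartic : exampleQuartic.IsHomogeneous 4 := by
  have hX : ∀ i : Fin 3, (MvPolynomial.X i : MvPolynomial (Fin 3) ℂ).IsHomogeneous 1 :=
    MvPolynomial.isHomogeneous_X ℂ
  exact (((((hX 0).pow 4).add ((hX 1).pow 4)).add (((hX 0).pow 2).mul ((hX 2).pow 2))).add
    ((hX 1).mul ((hX 2).pow 3))).add ((hX 2).pow 4)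

theorem eval_exampleQuartic (v : Fin 3 → ℂ) : MvPolynomial.eval v exampleQuartic =
    v 0 ^ 4 + v 1 ^ 4 + v 0 ^ 2 * v 2 ^ 2 + v 1 * v 2 ^ 3 + v 2 ^ 4 := by
  simp [exampleQuartic]

theorem isSmoothPlaneCurve_exampleQuartic : IsSmoothPlaneCurve exampleQuartic := by
  intro p hp _ hg
  have h0 := congrFun hg 0
  have h1 := congrFun hg 1
  have h2 := congrFun hg 2
  simp [gradientAt, exampleQuartic, MvPolynomial.pderiv_X] at h0 h1 h2
  generalize hx : p 0 = x at *
  generalize hy : p 1 = y at *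
  generalize hz : p 2 = z at *
  have key : x = 0 ∧ y = 0 ∧ z = 0 := by
    have h0' : x * (2 * x ^ 2 + z ^ 2) = 0 := by linear_combination (1 / 2) * h0
    have hz0 : z = 0 := by
      rcases mul_eq_zero.mp h0' with h | h
      · subst h
        have h3 : z ^ 2 * (3 * y + 4 * z) = 0 := by linear_combination h2
        rcases mul_eq_zero.mp h3 with h | h
        · exact pow_eq_zero_iff (by norm_num) |>.mp h
        · have hyz : y = -4 / 3 * z := by linear_combination (1 / 3) * h
          subst hyz
          have h4 : z ^ 3 = 0 := by linear_combination (-27 / 229) * h1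
          exact pow_eq_zero_iff (by norm_num) |>.mp h4
      · have h3 : z ^ 2 * (y + z) = 0 := by linear_combination (1 / 3) * h2 - (z / 3) * h
        rcases mul_eq_zero.mp h3 with h5 | h5
        · exact pow_eq_zero_iff (by norm_num) |>.mp h5
        · have hyz : y = -z := by linear_combination h5
          subst hyz
          have h4 : z ^ 3 = 0 := by linear_combination (-1 / 3) * h1
          exact pow_eq_zero_iff (by norm_num) |>.mp h4
    subst hz0
    refine ⟨?_, ?_, rfl⟩
    · have h4 : x ^ 3 = 0 := by linear_combination (1 / 4) * h0
      exact pow_eq_zero_iff (by norm_num) |>.mp h4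
    · have h4 : y ^ 3 = 0 := by linear_combination (1 / 4) * h1
      exact pow_eq_zero_iff (by norm_num) |>.mp h4
  apply hp
  funext i
  fin_cases i
  · exact hx.trans key.1
  · exact hy.trans key.2.1
  · exact hz.trans key.2.2

/-- The restriction has degree at most four, so divisibility by `X ^ 4` leaves only a monomial.
Homogenizing covers `s ≠ 0`, and density covers `s = 0`. -/
theorem exists_eval_exampleQuartic_eq {p q : Fin 3 → ℂ}
    (h : Polynomial.X ^ 4 ∣ restrictToLine exampleQuartic p q) :
    ∃ κ : ℂ, ∀ s t : ℂ, MvPolynomial.eval (s • p + t • q) exampleQuartic = κ * t ^ 4 := by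
  obtain ⟨r, hr⟩ := h
  have hdeg : (restrictToLine exampleQuartic p q).natDegree ≤ 4 := by
    simp only [restrictToLine, exampleQuartic, map_add, map_mul, map_pow, MvPolynomial.aeval_X]
    compute_degree
  obtain ⟨κ, rfl⟩ : ∃ κ, r = Polynomial.C κ := by
    by_cases hr0 : r = 0
    · exact ⟨0, by simp [hr0]⟩
    rw [hr, Polynomial.natDegree_X_pow_mul _ hr0] at hdeg
    exact ⟨r.coeff 0, Polynomial.eq_C_of_natDegree_eq_zero (by omega)⟩
  refine ⟨κ, fun s t => ?_⟩
  have hc : Continuous fun s : ℂ => MvPolynomial.eval (s • p + t • q) exampleQuartic :=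
    (MvPolynomial.continuous_eval _).comp (by fun_prop)
  refine congrFun (Continuous.ext_on (dense_compl_singleton (0 : ℂ)) hc
    (continuous_const (y := κ * t ^ 4)) fun s hs => ?_) s
  have hs : s ≠ 0 := hs
  have h1 : s • p + t • q = s • (p + (t / s) • q) := by
    rw [smul_add, smul_smul, mul_div_cancel₀ _ hs]
  rw [h1, eval_smul_of_isHomogeneous isHomogeneous_exampleQuartic, ← eval_restrictToLine, hr]
  simp
  field_simp

theorem not_fourth_power_of_vertical_line (κ l m : ℂ)
    (h : ∀ y z : ℂ, y ^ 4 + y * z ^ 3 + z ^ 4 = κ * (l * y + m * z) ^ 4) : False := by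
  -- Values at these five points determine a binary quartic, so linear combinations of them read off
  -- its coefficients.
  have e1 := h 1 0
  have e2 := h 0 1
  have e3 := h 1 1
  have e4 := h 1 (-1)
  have e5 := h 1 2
  have h3 : 4 * (κ * l * m ^ 3) = 1 := by
    linear_combination -(1 / 2) * e1 + 2 * e2 + (1 / 2) * e3 + (1 / 6) * e4 - (1 / 6) * e5
  have h2 : κ * l ^ 2 * m ^ 2 = 0 := by
    linear_combination (1 / 6) * e1 + (1 / 6) * e2 - (1 / 12) * e3 - (1 / 12) * e4
  have hne : κ ≠ 0 ∧ l ≠ 0 ∧ m ≠ 0 := by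
    refine ⟨?_, ?_, ?_⟩ <;> rintro rfl <;> simp at h3
  simp [hne] at h2

/-- The `x²z²` coefficient forces `κ`, `l`, `m` to be nonzero, while the `x³z` coefficient requires
`κ * l ^ 3 * m = 0`. -/
theorem not_fourth_power_of_line_through (γ κ l m : ℂ)
    (h : ∀ x z : ℂ, x ^ 4 + (γ * x) ^ 4 + x ^ 2 * z ^ 2 + γ * x * z ^ 3 + z ^ 4 =
      κ * (l * x + m * z) ^ 4) : False := by
  have e1 := h 1 0
  have e2 := h 0 1
  have e3 := h 1 1
  have e4 := h 1 (-1)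
  have e5 := h 1 2
  have h2 : 6 * (κ * l ^ 2 * m ^ 2) = 1 := by
    linear_combination e1 + e2 - (1 / 2) * e3 - (1 / 2) * e4
  have h1 : κ * l ^ 3 * m = 0 := by
    linear_combination (1 / 8) * e1 - (1 / 2) * e2 - (1 / 4) * e3 + (1 / 12) * e4 + (1 / 24) * e5
  have hne : κ ≠ 0 ∧ l ≠ 0 ∧ m ≠ 0 := by
    refine ⟨?_, ?_, ?_⟩ <;> rintro rfl <;> simp at h2
  simp [hne] at h1

theorem not_common_root_of_eliminants (β : ℂ)
    (h1 : 240 + 384 * β + 156 * β ^ 3 + 384 * β ^ 4 + 192 * β ^ 5 - 3 * β ^ 6 = 0)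
    (h3 : (-38400) * β ^ 1 + (-122880) * β ^ 2 + (26112) * β ^ 3 + (776448) * β ^ 4 + (1824768) * β
      ^ 5 + (1885824) * β ^ 6 + (602592) * β ^ 7 + (-294912) * β ^ 8 + (-242280) * β ^ 9 +
      (-92640) * β ^ 10 + (-19872) * β ^ 11 + (768) * β ^ 12 = 0) : False := by
  have : (1 : ℂ) = 0 := by
    -- A Bézout identity for the two coprime eliminants, of degrees 6 and 12, with cofactors of
    -- degrees 11 and 5.
    linear_combination ((1/240) * β ^ 0 + (-869485804210375614493/173222162252672064080) * β ^ 1 +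
      (-4376821125622839171593/541319257039600200250) * β ^ 2 +
      (280977416211271094291101/17322216225267206408000) * β ^ 3 +
      (1310406893291709508641321/17322216225267206408000) * β ^ 4 +
      (2049427173634606394912103/17322216225267206408000) * β ^ 5 +
      (6097390885939085891741279/103933297351603238448000) * β ^ 6 +
      (-2975827828836101590739483/207866594703206476896000) * β ^ 7 +
      (-219073705649293730295573/13857772980213765126400) * β ^ 8 +
      (-8538746998330911031483/1299166216895040480600) * β ^ 9 +
      (-87132500700490169540567/51966648675801619224000) * β ^ 10 +
      (410909783325509153041/6495831084475202403000) * β ^ 11) * h1 +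
      ((-13024964846930367010987/415733189406412953792000) * β ^ 0 +
      (-614103730817088551/1299166216895040480600) * β ^ 1 +
      (311529461692823217187/415733189406412953792000) * β ^ 2 +
      (-17919725889078519669379/831466378812825907584000) * β ^ 3 +
      (-26557498076846307652259/1662932757625651815168000) * β ^ 4 +
      (410909783325509153041/1662932757625651815168000) * β ^ 5) * h3
  exact one_ne_zero this

/-- The first two relations are linear in `u`. Eliminating `u` between them gives one polynomial in
`β`; substituting `u` from the second into the third gives the other. Multiplying by powers of `D`,
the coefficient of `u` in the second, avoids assuming `D ≠ 0`. -/
theorem eliminants_of_relations (u β : ℂ) (hβ : β ≠ 0)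
    (r14 : 6 * (2 * β + u * (1 + 4 * β)) * (1 + β ^ 3 + β ^ 4) =
      β ^ 2 * (β + 3 * u * (1 + 2 * β)) * (β * (3 + 4 * β)))
    (r33 : 3 * u * β * (β * (3 + 4 * β)) ^ 2 =
      8 * (β + 3 * u * (1 + 2 * β)) * (1 + β ^ 3 + β ^ 4))
    (r02 : 8 * (1 + u + u ^ 2) * β * (β + 3 * u * (1 + 2 * β)) =
      3 * u * (2 * β + u * (1 + 4 * β)) ^ 2) : False := by
  obtain ⟨D, hD⟩ : ∃ D, D = 3 * β * (β * (3 + 4 * β)) ^ 2 -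
    24 * (1 + β ^ 3 + β ^ 4) * (1 + 2 * β) := ⟨_, rfl⟩
  have hu : u * D = 8 * β * (1 + β ^ 3 + β ^ 4) := by
    rw [hD]; linear_combination r33
  have hE : u * (6 * (1 + β ^ 3 + β ^ 4) * (1 + 4 * β) -
      3 * β ^ 2 * (β * (3 + 4 * β)) * (1 + 2 * β)) =
      β * (β ^ 2 * (β * (3 + 4 * β)) - 12 * (1 + β ^ 3 + β ^ 4)) := by
    linear_combination r14
  have hR1 : β * (240 + 384 * β + 156 * β ^ 3 + 384 * β ^ 4 + 192 * β ^ 5 - 3 * β ^ 6) = 0 := by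
    subst hD
    linear_combination (6 * (1 + β ^ 3 + β ^ 4) * (1 + 4 * β) -
      3 * β ^ 2 * (β * (3 + 4 * β)) * (1 + 2 * β)) * hu - (3 * β * (β * (3 + 4 * β)) ^ 2 -
      24 * (1 + β ^ 3 + β ^ 4) * (1 + 2 * β)) * hE
  have ha : D * (2 * β + u * (1 + 4 * β)) =
      β * (2 * D + 8 * (1 + β ^ 3 + β ^ 4) * (1 + 4 * β)) := by
    linear_combination (1 + 4 * β) * hu
  have hb : D * (β + 3 * u * (1 + 2 * β)) =
      β * (D + 24 * (1 + β ^ 3 + β ^ 4) * (1 + 2 * β)) := by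
    linear_combination 3 * (1 + 2 * β) * hu
  have hf : D ^ 2 * (1 + u + u ^ 2) =
      D ^ 2 + D * (8 * β * (1 + β ^ 3 + β ^ 4)) + (8 * β * (1 + β ^ 3 + β ^ 4)) ^ 2 := by
    rw [← hu]; ring
  have hR3 : β ^ 2 * (8 * (D ^ 2 + D * (8 * β * (1 + β ^ 3 + β ^ 4)) +
      (8 * β * (1 + β ^ 3 + β ^ 4)) ^ 2) * (D + 24 * (1 + β ^ 3 + β ^ 4) * (1 + 2 * β)) -
      24 * β * (1 + β ^ 3 + β ^ 4) *
        (2 * D + 8 * (1 + β ^ 3 + β ^ 4) * (1 + 4 * β)) ^ 2) = 0 := by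
    have h1 : 8 * (D ^ 2 * (1 + u + u ^ 2)) * β * (D * (β + 3 * u * (1 + 2 * β))) =
        3 * (u * D) * (D * (2 * β + u * (1 + 4 * β))) ^ 2 := by
      linear_combination D ^ 3 * r02
    rw [ha, hb, hf, hu] at h1
    linear_combination h1
  have hR1' := (mul_eq_zero.mp hR1).resolve_left hβ
  have hR3' := (mul_eq_zero.mp hR3).resolve_left (pow_ne_zero 2 hβ)
  refine not_common_root_of_eliminants β hR1' ?_
  rw [← hR3', hD]
  ring

theorem not_fourth_power_of_graph (α β κ l m : ℂ)
    (h : ∀ x y : ℂ, x ^ 4 + y ^ 4 + x ^ 2 * (α * x + β * y) ^ 2 + y * (α * x + β * y) ^ 3 +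
      (α * x + β * y) ^ 4 = κ * (l * x + m * y) ^ 4) : False := by
  have e1 := h 1 0
  have e2 := h 0 1
  have e3 := h 1 1
  have e4 := h 1 (-1)
  have e5 := h 1 2
  have h0 : 1 + α ^ 2 + α ^ 4 = κ * l ^ 4 := by linear_combination e1
  have h4 : 1 + β ^ 3 + β ^ 4 = κ * m ^ 4 := by linear_combination e2
  have h1 : 2 * α * β + α ^ 3 + 4 * α ^ 3 * β = 4 * κ * l ^ 3 * m := by
    linear_combination -(1 / 2) * e1 + 2 * e2 + e3 - (1 / 3) * e4 - (1 / 6) * e5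
  have h2 : β ^ 2 + 3 * α ^ 2 * β + 6 * α ^ 2 * β ^ 2 = 6 * κ * l ^ 2 * m ^ 2 := by
    linear_combination -e1 - e2 + (1 / 2) * e3 + (1 / 2) * e4
  have h3 : 3 * α * β ^ 2 + 4 * α * β ^ 3 = 4 * κ * l * m ^ 3 := by
    linear_combination (1 / 2) * e1 - 2 * e2 - (1 / 2) * e3 - (1 / 6) * e4 + (1 / 6) * e5
  clear h e1 e2 e3 e4 e5
  by_cases hβ : β = 0
  · subst hβ
    have hm : κ * m ^ 4 = 1 := by linear_combination -h4
    have hne : κ ≠ 0 ∧ m ≠ 0 := by refine ⟨?_, ?_⟩ <;> rintro rfl <;> simp at hm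
    have hl : l = 0 := by simpa [hne] using h3
    subst hl
    have hα : α = 0 := by simpa using h1
    subst hα
    simp at h0
  by_cases hα : α = 0
  · subst hα
    have hm : κ * l ^ 4 = 1 := by linear_combination -h0
    have hne : κ ≠ 0 ∧ l ≠ 0 := by refine ⟨?_, ?_⟩ <;> rintro rfl <;> simp at hm
    have hm0 : m = 0 := by simpa [hne] using h1
    subst hm0
    exact hβ (by simpa using h2)
  -- Put `c i = κ * l ^ (4 - i) * m ^ i`, the coefficients freed of binomial factors. The relations
  -- are `c 1 * c 4 = c 2 * c 3`, `c 3 ^ 2 = c 2 * c 4` and `c 0 * c 2 = c 1 ^ 2`, the first two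
  -- after cancelling `α` and `β`.
  refine eliminants_of_relations (α ^ 2) β hβ ?_ ?_ ?_
  · refine mul_left_cancel₀ hα ?_
    linear_combination 6 * (1 + β ^ 3 + β ^ 4) * h1 + 24 * κ * l ^ 3 * m * h4 -
      (β ^ 2 + 3 * α ^ 2 * β + 6 * α ^ 2 * β ^ 2) * h3 - 4 * κ * l * m ^ 3 * h2
  · refine mul_left_cancel₀ hβ ?_
    linear_combination 3 * (3 * α * β ^ 2 + 4 * α * β ^ 3) * h3 + 12 * κ * l * m ^ 3 * h3 -
      8 * (1 + β ^ 3 + β ^ 4) * h2 - 48 * κ * l ^ 2 * m ^ 2 * h4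
  · linear_combination 8 * (1 + α ^ 2 + α ^ 4) * h2 + 48 * κ * l ^ 2 * m ^ 2 * h0 -
      3 * (2 * α * β + α ^ 3 + 4 * α ^ 3 * β) * h1 - 12 * κ * l ^ 3 * m * h1

theorem not_hasHyperflex_exampleQuartic : ¬ HasHyperflex exampleQuartic := by
  rintro ⟨p, q, h, hdvd⟩
  obtain ⟨κ, hκ⟩ := exists_eval_exampleQuartic_eq hdvd
  have hκ' : ∀ s t, (s * p 0 + t * q 0) ^ 4 + (s * p 1 + t * q 1) ^ 4 +
      (s * p 0 + t * q 0) ^ 2 * (s * p 2 + t * q 2) ^ 2 +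
      (s * p 1 + t * q 1) * (s * p 2 + t * q 2) ^ 3 + (s * p 2 + t * q 2) ^ 4 = κ * t ^ 4 := by
    intro s t
    rw [← hκ s t, eval_exampleQuartic]
    simp
  -- The cross product `(a, b, c)` gives the equation of the line. It can be solved for the third,
  -- second or first coordinate according to which entry is nonzero. Cramer's rule then supplies the
  -- parameters `s`, `t` of a given point, and `t` is the linear form whose fourth power appears.
  obtain ⟨a, ha⟩ : ∃ a, p 1 * q 2 - p 2 * q 1 = a := ⟨_, rfl⟩
  obtain ⟨b, hb⟩ : ∃ b, p 2 * q 0 - p 0 * q 2 = b := ⟨_, rfl⟩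
  obtain ⟨c, hc⟩ : ∃ c, p 0 * q 1 - p 1 * q 0 = c := ⟨_, rfl⟩
  have hne := exists_minor_ne_zero h
  rw [ha, hb, hc] at hne
  by_cases hc0 : c = 0
  · by_cases hb0 : b = 0
    · have ha0 : a ≠ 0 := by tauto
      refine not_fourth_power_of_vertical_line κ (-p 2 / a) (p 1 / a) fun y z => ?_
      have hk := hκ' ((y * q 2 - z * q 1) / a) ((p 1 * z - p 2 * y) / a)
      have c0 : (y * q 2 - z * q 1) / a * p 0 + (p 1 * z - p 2 * y) / a * q 0 = 0 := by
        field_simp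
        linear_combination -y * hb - y * hb0 - z * hc - z * hc0
      have c1 : (y * q 2 - z * q 1) / a * p 1 + (p 1 * z - p 2 * y) / a * q 1 = y := by
        field_simp
        linear_combination y * ha
      have c2 : (y * q 2 - z * q 1) / a * p 2 + (p 1 * z - p 2 * y) / a * q 2 = z := by
        field_simp
        linear_combination z * ha
      rw [c0, c1, c2] at hk
      linear_combination hk
    · refine not_fourth_power_of_line_through (-a / b) κ (p 2 / b) (-p 0 / b) fun x z => ?_
      have hk := hκ' ((z * q 0 - x * q 2) / b) ((p 2 * x - p 0 * z) / b)
      have c0 : (z * q 0 - x * q 2) / b * p 0 + (p 2 * x - p 0 * z) / b * q 0 = x := by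
        field_simp
        linear_combination x * hb
      have c1 : (z * q 0 - x * q 2) / b * p 1 + (p 2 * x - p 0 * z) / b * q 1 = -a / b * x := by
        field_simp
        linear_combination -z * hc - z * hc0 - x * ha
      have c2 : (z * q 0 - x * q 2) / b * p 2 + (p 2 * x - p 0 * z) / b * q 2 = z := by
        field_simp
        linear_combination z * hb
      rw [c0, c1, c2] at hk
      linear_combination hk
  · refine not_fourth_power_of_graph (-a / c) (-b / c) κ (-p 1 / c) (p 0 / c) fun x y => ?_
    have hk := hκ' ((x * q 1 - y * q 0) / c) ((p 0 * y - p 1 * x) / c)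
    have c0 : (x * q 1 - y * q 0) / c * p 0 + (p 0 * y - p 1 * x) / c * q 0 = x := by
      field_simp
      linear_combination x * hc
    have c1 : (x * q 1 - y * q 0) / c * p 1 + (p 0 * y - p 1 * x) / c * q 1 = y := by
      field_simp
      linear_combination y * hc
    have c2 : (x * q 1 - y * q 0) / c * p 2 + (p 0 * y - p 1 * x) / c * q 2 =
        -a / c * x + -b / c * y := by
      field_simp
      linear_combination -x * ha - y * hb
    rw [c0, c1, c2] at hk
    linear_combination hk

/-! ### Irreducibility of the explicit quartic. -/

/-- A square root would be quadratic; the missing cubic term kills its linear coefficient, and with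
it the linear term of the square. -/
theorem Polynomial.sq_ne_quartic_of_linear_coeff_ne_zero {k l m : ℂ} (hk : k ≠ 0) (hl : l ≠ 0)
    (a : Polynomial ℂ) : a ^ 2 ≠ C k * X ^ 4 + C l * X + C m := by
  intro h
  have hdeg : (C k * X ^ 4 + C l * X + C m : Polynomial ℂ).natDegree = 4 := by
    compute_degree!
  have hd : a.natDegree ≤ 2 := by
    have h1 := congrArg natDegree h
    rw [natDegree_pow, hdeg] at h1
    omega
  obtain ⟨p, q, r, rfl⟩ : ∃ p q r : ℂ, a = C p * X ^ 2 + C q * X + C r :=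
    ⟨_, _, _, eq_quadratic_of_degree_le_two (natDegree_le_iff_degree_le.mp hd)⟩
  have hexp : (C p * X ^ 2 + C q * X + C r) ^ 2 = C (p ^ 2) * X ^ 4 + C (2 * p * q) * X ^ 3 +
      C (q ^ 2 + 2 * p * r) * X ^ 2 + C (2 * q * r) * X + C (r ^ 2) := by
    simp only [map_add, map_mul, map_pow, map_ofNat]
    ring
  rw [hexp] at h
  have c4 : p ^ 2 = k := by
    simpa [coeff_X, coeff_C, -map_add, -map_mul, -map_pow] using congrArg (coeff · 4) h
  have c3 : p = 0 ∨ q = 0 := by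
    simpa [coeff_X, coeff_C, -map_add, -map_mul, -map_pow] using congrArg (coeff · 3) h
  have c1 : 2 * q * r = l := by
    simpa [coeff_X, coeff_C, -map_add, -map_mul, -map_pow] using congrArg (coeff · 1) h
  rcases c3 with rfl | rfl
  · exact hk (by simpa using c4.symm)
  · exact hl (by simpa using c1.symm)

/-- A root `ρ` makes `b ^ 2 - 4 * c` the square of `2 * ρ ^ 2 + b`. Two monic quadratic factors have
opposite linear coefficients; either these vanish and the discriminant is a square, or the constant
terms agree and `c` is a square. -/
theorem Polynomial.irreducible_biquadratic {R : Type*} [CommRing R] [IsDomain R] {b c : R}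
    (hc : ∀ a, a ^ 2 ≠ c) (hbc : ∀ a, a ^ 2 ≠ b ^ 2 - 4 * c) :
    Irreducible (X ^ 4 + C b * X ^ 2 + C c : Polynomial R) := by
  have hmon : (X ^ 4 + C b * X ^ 2 + C c : Polynomial R).Monic := by monicity!
  have hdeg : (X ^ 4 + C b * X ^ 2 + C c : Polynomial R).natDegree = 4 := by compute_degree!
  rw [hmon.irreducible_iff_natDegree']
  refine ⟨fun h => by simp [h] at hdeg, fun f g hf hg hfg hmem => ?_⟩
  rw [hdeg, Finset.mem_Ioc] at hmem
  have hsum : f.natDegree + g.natDegree = 4 := by rw [← hf.natDegree_mul hg, hfg, hdeg]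
  obtain hg1 | hg2 : g.natDegree = 1 ∨ g.natDegree = 2 := by omega
  · have hroot : g.eval (-g.coeff 0) = 0 := by
      conv_lhs => rw [hg.eq_X_add_C hg1]
      simp
    have h0 := congrArg (eval (-g.coeff 0)) hfg
    rw [eval_mul, hroot, mul_zero] at h0
    simp only [eval_add, eval_mul, eval_pow, eval_X, eval_C] at h0
    exact hbc (2 * (g.coeff 0) ^ 2 + b) (by linear_combination -4 * h0)
  · have hquad : ∀ {e : Polynomial R}, e.Monic → e.natDegree = 2 →
        e = X ^ 2 + C (e.coeff 1) * X + C (e.coeff 0) := by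
      intro e he h2
      have h := eq_quadratic_of_degree_le_two (natDegree_le_iff_degree_le.mp h2.le)
      rwa [← h2, he.coeff_natDegree, h2, C_1, one_mul] at h
    rw [hquad hf (by omega), hquad hg hg2] at hfg
    generalize f.coeff 1 = a at hfg
    generalize f.coeff 0 = s at hfg
    generalize g.coeff 1 = a' at hfg
    generalize g.coeff 0 = t at hfg
    have hexp : (X ^ 2 + C a * X + C s) * (X ^ 2 + C a' * X + C t) = X ^ 4 + C (a + a') * X ^ 3 +
        C (s + t + a * a') * X ^ 2 + C (a * t + a' * s) * X + C (s * t) := by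
      simp only [map_add, map_mul]
      ring
    rw [hexp] at hfg
    have c3 : a + a' = 0 := by
      simpa [coeff_X, coeff_C, -map_add, -map_mul] using congrArg (coeff · 3) hfg
    have c2 : s + t + a * a' = b := by
      simpa [coeff_X, coeff_C, -map_add, -map_mul] using congrArg (coeff · 2) hfg
    have c1 : a * t + a' * s = 0 := by
      simpa [coeff_X, coeff_C, -map_add, -map_mul] using congrArg (coeff · 1) hfg
    have c0 : s * t = c := by
      simpa [coeff_X, coeff_C, -map_add, -map_mul] using congrArg (coeff · 0) hfg
    obtain rfl : a' = -a := by linear_combination c3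
    rcases mul_eq_zero.mp (show a * (t - s) = 0 by linear_combination c1) with rfl | h
    · refine hbc (s - t) ?_
      rw [← c2, ← c0]
      ring
    · exact hc s (by linear_combination c0 - s * h)

theorem irreducible_exampleQuartic : Irreducible exampleQuartic := by
  have h1 : (1 : Fin 3) = Fin.succ 0 := rfl
  have h2 : (2 : Fin 3) = Fin.succ 1 := rfl
  have himg : MvPolynomial.finSuccEquiv ℂ 2 exampleQuartic =
      Polynomial.X ^ 4 + Polynomial.C (MvPolynomial.X 1 ^ 2) * Polynomial.X ^ 2 +
        Polynomial.C (MvPolynomial.X 0 ^ 4 + MvPolynomial.X 0 * MvPolynomial.X 1 ^ 3 +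
          MvPolynomial.X 1 ^ 4) := by
    simp only [exampleQuartic, map_add, map_mul, map_pow, h1, h2,
      MvPolynomial.finSuccEquiv_X_zero, MvPolynomial.finSuccEquiv_X_succ]
    ring
  rw [← MulEquiv.irreducible_iff (MvPolynomial.finSuccEquiv ℂ 2), himg]
  -- The quartic is biquadratic in `x` over `ℂ[y, z]`. Setting `z = 1` preserves squares and turns
  -- the constant term and the discriminant into one-variable quartics with no cubic or quadratic
  -- term.
  let φ : MvPolynomial (Fin 2) ℂ →ₐ[ℂ] Polynomial ℂ := MvPolynomial.aeval ![Polynomial.X, 1]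
  refine Polynomial.irreducible_biquadratic (fun a ha => ?_) fun a ha => ?_
  · refine Polynomial.sq_ne_quartic_of_linear_coeff_ne_zero (one_ne_zero (α := ℂ))
      (one_ne_zero (α := ℂ)) (m := 1) (φ a) ?_
    rw [← map_pow, ha]
    simp [φ]
  · refine Polynomial.sq_ne_quartic_of_linear_coeff_ne_zero (k := -4) (l := -4) (m := -3)
      (by norm_num) (by norm_num) (φ a) ?_
    rw [← map_pow, ha]
    simp only [map_sub, map_add, map_mul, map_pow, map_ofNat, map_neg, φ, MvPolynomial.aeval_X,
      Matrix.cons_val_zero, Matrix.cons_val_one]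
    ring

/-! ### Assembly. -/

theorem analyticAt_eval_mvPolynomial (P : MvPolynomial (Fin 3) ℂ) (x : Fin 3 → ℂ) :
    AnalyticAt ℂ (fun x => MvPolynomial.eval x P) x :=
  AnalyticOnNhd.eval_mvPolynomial P x (Set.mem_univ x)

theorem MvPolynomial.IsHomogeneous.isInitialForm_eval {P : MvPolynomial (Fin 3) ℂ} {d : ℕ}
    (hP : P.IsHomogeneous d) (h0 : P ≠ 0) : IsInitialForm (fun x => eval x P) d P := by
  refine ⟨hP, h0, ?_⟩
  simp only [sub_self]
  exact Asymptotics.isLittleO_zero _ _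

theorem isHypersurfaceGerm_exampleQuartic :
    IsHypersurfaceGerm (zeroLocus fun x => MvPolynomial.eval x exampleQuartic) := by
  refine ⟨_, analyticAt_eval_mvPolynomial _ 0, ?_, fun h => ?_, EventuallyEq.rfl⟩
  · simp only [eval_exampleQuartic]
    simp
  · have ht : Tendsto (fun s : ℂ => (![s, 0, 0] : Fin 3 → ℂ)) (𝓝[≠] 0) (𝓝 0) := by
      refine Tendsto.mono_left ?_ nhdsWithin_le_nhds
      refine tendsto_pi_nhds.mpr fun i => ?_
      fin_cases i
      · exact tendsto_id
      · exact tendsto_const_nhds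
      · exact tendsto_const_nhds
    obtain ⟨s, hs, hs0⟩ := ((ht.eventually h).and self_mem_nhdsWithin).exists
    exact hs0 (by simpa [eval_exampleQuartic] using hs)

theorem mainTheorem2 :
    -- existence
    (∃ X : Set (Fin 3 → ℂ), IsHypersurfaceGerm X ∧ IsIrreducibleGerm X ∧
      AllSmoothSectionsReducible X) ∧
    -- germs whose tangent cone has degree at least four and no hyperflexes
    (∀ (F : (Fin 3 → ℂ) → ℂ) (d : ℕ) (P : MvPolynomial (Fin 3) ℂ),
      AnalyticAt ℂ F 0 → IsInitialForm F d P → 4 ≤ d → ¬ HasHyperflex P →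
        AllSmoothSectionsReducible (zeroLocus F) ∧
        (Irreducible P → IsIrreducibleGerm (zeroLocus F))) ∧
    -- the explicit quartic
    (exampleQuartic.IsHomogeneous 4 ∧ IsSmoothPlaneCurve exampleQuartic ∧
      Irreducible exampleQuartic ∧ ¬ HasHyperflex exampleQuartic ∧
      IsIrreducibleGerm (zeroLocus fun x => MvPolynomial.eval x exampleQuartic) ∧
      AllSmoothSectionsReducible (zeroLocus fun x => MvPolynomial.eval x exampleQuartic)) ∧
    -- germs whose tangent cone is the union of two non-tangent smooth conics
    (∀ (F : (Fin 3 → ℂ) → ℂ) (Q₁ Q₂ : MvPolynomial (Fin 3) ℂ),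
      AnalyticAt ℂ F 0 → Q₁.IsHomogeneous 2 → Q₂.IsHomogeneous 2 →
      IsSmoothPlaneCurve Q₁ → IsSmoothPlaneCurve Q₂ → AreNonTangent Q₁ Q₂ →
      IsInitialForm F 4 (Q₁ * Q₂) →
        ¬ HasHyperflex (Q₁ * Q₂) ∧ AllSmoothSectionsReducible (zeroLocus F)) := by
  have hinit := isHomogeneous_exampleQuartic.isInitialForm_eval irreducible_exampleQuartic.ne_zero
  have hirr := isIrreducibleGerm_zeroLocus (analyticAt_eval_mvPolynomial exampleQuartic 0) hinit
    four_ne_zero irreducible_exampleQuartic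
  have hred := allSmoothSectionsReducible_of_not_hasHyperflex
    (analyticAt_eval_mvPolynomial exampleQuartic 0) hinit le_rfl not_hasHyperflex_exampleQuartic
  refine ⟨⟨_, isHypersurfaceGerm_exampleQuartic, hirr, hred⟩, ?_, ?_, ?_⟩
  · intro F d P hFa hF hd hfl
    exact ⟨allSmoothSectionsReducible_of_not_hasHyperflex hFa hF hd hfl,
      isIrreducibleGerm_zeroLocus hFa hF (by omega)⟩
  · exact ⟨isHomogeneous_exampleQuartic, isSmoothPlaneCurve_exampleQuartic,
      irreducible_exampleQuartic, not_hasHyperflex_exampleQuartic, hirr, hred⟩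
  · intro F Q₁ Q₂ hFa h₁ h₂ hs₁ hs₂ ht hF
    have hfl := not_hasHyperflex_mul_conics h₁ h₂ hs₁ hs₂ ht
    exact ⟨hfl, allSmoothSectionsReducible_of_not_hasHyperflex hFa hF le_rfl hfl⟩
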